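/- **Setting.** A *stably structured category* $(\mathcal C,\mathcal S)$ is a category $\mathcal C$ with a class $\mathcal S$ of morphisms that contains all isomorphisms, is closed under composition, and is such that pullbacks of $\mathcal S$-morphisms along arbitrary morphisms exist and lie in $\mathcal S$. $\mathfrak{StableCat}$ is the 2-category of these; 1-cells $F:(\mathcal C,\mathcal S)\to(\mathcal D,\mathcal T)$ are functors with $F(\mathcal S)\subseteq\mathcal T$ preserving pullbacks along $\mathcal S$-morphisms, and 2-cells are natural transformations whose naturality squares at $\mathcal S$-morphisms are pullbacks. $\mathfrak{StableCat}_{\rm mono}$ is its full sub-2-category on the $(\mathcal C,\mathcal S)$ with $\mathcal S$ a class of monomorphisms. An $\mathcal S$-span $(s,f):A\to B$ is a pair $A\xleftarrow{\,s\,}D\xrightarrow{\,f\,}B$ with $s\in\mathcal S$. If $f:A\to B$, $s:D\to B$ and $v:B\to B'$ with $s,v\in\mathcal S$, the induced morphism $v^\star:A\times_BD\to A\times_{B'}D$ is called a conjugate, and $\mathcal S^\star$ is the class of all existing pullbacks in $\mathcal C$ of conjugates. Let $\sim$ be the least equivalence relation on $\mathcal S$-spans with $(\tilde s x,\tilde f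 x)\sim(\tilde s,\tilde f)$ whenever both are $\mathcal S$-spans and $x\in\mathcal S^\star$. $\mathsf{Par}(\mathcal C,\mathcal S)$ has the objects of $\mathcal C$, the classes $[s,f]$ as morphisms, composition by pullback, and restriction $\overline{[s,f]}=[s,s]$; it is a split restriction category. $\mathfrak{SplitRestCat}$ is the 2-category of split restriction categories, restriction-preserving functors, and natural transformations with total components ($f$ is total if $\bar f=1$). For a split restriction category $\mathcal X$, $\mathsf{Total}(\mathcal X)$ is its category of total morphisms, structured by the class of total restricted isomorphisms (total $i$ with some $i^-$ such that $i^-i=\bar i$ and $i\,i^-=\overline{i^-}$). Let $\mathfrak{StableCat}'$ be the sub-2-category of $\mathfrak{StableCat}$ with all objects, those 1-cells $F$ for which $\mathsf{Par}(F):[s,f]\mapsto[Fs,Ff]$ is well defined, and all 2-cells between them. Then $\mathsf{Par}$ (with $\alpha\mapsto[1,\alpha]$ on 2-cells) is a 2-functor $\mathfrak{StableCat}'\to\mathfrak{SplitRestCat}$, $\mathsf{Total}$ is a 2-functor $\mathfrak{SplitRestCat}\to\mathfrak{StableCat}'$, and $\mathfrak{StableCat}_{\rm mono}$ is a full sub-2-category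 of $\mathfrak{StableCat}'$. **Statement.** There is a 2-adjunction $\mathsf{Par}\dashv\mathsf{Total}:\mathfrak{SplitRestCat}\to\mathfrak{StableCat}'$ with unit $\eta_{(\mathcal C,\mathcal S)}:\mathcal C\to\mathsf{Total}(\mathsf{Par}(\mathcal C,\mathcal S))$, $f\mapsto[1,f]$, and counit $\varepsilon_{\mathcal X}:\mathsf{Par}(\mathsf{Total}(\mathcal X))\to\mathcal X$, $[s,f]\mapsto f\cdot s^-$, such that: 1. for every stably structured category $(\mathcal C,\mathcal S)$, $\eta_{(\mathcal C,\mathcal S)}$ is an isomorphism (in $\mathfrak{StableCat}$, and equally in $\mathfrak{StableCat}'$) if and only if every morphism in $\mathcal S$ is a monomorphism of $\mathcal C$; 2. for every split restriction category $\mathcal X$, $\varepsilon_{\mathcal X}$ is an isomorphism; 3. $\mathsf{Par}$ and $\mathsf{Total}$ restrict to $\mathfrak{StableCat}_{\rm mono}$ and $\mathfrak{SplitRestCat}$, and the restricted 2-adjunction, with the same unit and counit, is a 2-equivalence between them (all its units and counits are isomorphisms). This is the Cockett–Lack 2-equivalence: when $\mathcal S$ is a class of monomorphisms, two $\mathcal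 S$-spans are $\sim$-related if and only if they are isomorphic, so that $\mathsf{Par}(\mathcal C,\mathcal S)$ is the usual category of isomorphism classes of $\mathcal S$-spans. -/

import Mathlib

open CategoryTheory CategoryTheory.Limits Bicategory

universe w v u v' u'

namespace PartialMaps

/-- A class of morphisms containing all isomorphisms and closed under composition, such that
pullbacks of its members along arbitrary morphisms exist and are members again. -/
structure StableClass (C : Type u) [Category.{v} C] where
  W : MorphismProperty C
  iso_mem : ∀ {A B : C} (f : A ⟶ B), IsIso f → W f
  comp_mem : ∀ {A B D : C} {f : A ⟶ B} {g : B ⟶ D}, W f → W g → W (f ≫ g)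
  hasPullback : ∀ {A B D : C} (f : A ⟶ B) {s : D ⟶ B}, W s → HasPullback f s
  pullback_mem : ∀ {P A B D : C} {s' : P ⟶ A} {f' : P ⟶ D} {f : A ⟶ B} {s : D ⟶ B},
    IsPullback s' f' f s → W s → W s'

section Par

variable {C : Type u} [Category.{v} C] (S : StableClass C)

/-- `y` is the conjugate of an `S`-cospan morphism `v : ⟨f, s⟩ ⟶ ⟨f ≫ v, s ≫ v⟩` with `v` in `S`:
the morphism induced between the pullbacks of the two cospans. -/
def IsConjugate {P Q : C} (y : P ⟶ Q) : Prop :=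
  ∃ (A D B B' : C) (f : A ⟶ B) (s : D ⟶ B) (v : B ⟶ B')
    (s' : P ⟶ A) (f' : P ⟶ D) (t' : Q ⟶ A) (g' : Q ⟶ D),
    S.W s ∧ S.W v ∧ IsPullback s' f' f s ∧ IsPullback t' g' (f ≫ v) (s ≫ v) ∧
      y ≫ t' = s' ∧ y ≫ g' = f'

/-- The class `S⋆` of all existing pullbacks of conjugates. -/
def Star {X Y : C} (x : X ⟶ Y) : Prop :=
  ∃ (P Q : C) (y : P ⟶ Q) (a : X ⟶ P) (b : Y ⟶ Q), IsConjugate S y ∧ IsPullback a x y b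

/-- `S`-spans from `A` to `B`. -/
structure SSpan (A B : C) where
  apex : C
  left : apex ⟶ A
  right : apex ⟶ B
  mem : S.W left

variable {S}

/-- The relation `p ≤⋆ q`. -/
def SSpan.Le {A B : C} (p q : SSpan S A B) : Prop :=
  ∃ x : p.apex ⟶ q.apex, Star S x ∧ x ≫ q.left = p.left ∧ x ≫ q.right = p.right

/-- Vertical isomorphism of spans. -/
def SSpan.IsIsomorphic {A B : C} (p q : SSpan S A B) : Prop :=
  ∃ x : p.apex ≅ q.apex, x.hom ≫ q.left = p.left ∧ x.hom ≫ q.right = p.right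

/-- The least equivalence relation containing `≤⋆`. -/
def SSpan.Rel {A B : C} (p q : SSpan S A B) : Prop := Relation.EqvGen SSpan.Le p q

variable (S) in
/-- `SSpan.Rel` as a setoid. -/
def SSpan.setoid (A B : C) : Setoid (SSpan S A B) := Relation.EqvGen.setoid SSpan.Le

lemma star_of_isIso {X Y : C} (x : X ⟶ Y) [IsIso x] : Star S x := by
  refine ⟨Y, Y, 𝟙 Y, x, 𝟙 Y, ⟨Y, Y, Y, Y, 𝟙 Y, 𝟙 Y, 𝟙 Y, 𝟙 Y, 𝟙 Y, 𝟙 Y, 𝟙 Y, S.iso_mem _ inferInstance,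
    S.iso_mem _ inferInstance, ?_, ?_, by simp, by simp⟩, ?_⟩
  · exact IsPullback.of_vert_isIso ⟨by simp⟩
  · exact IsPullback.of_vert_isIso ⟨by simp⟩
  · exact IsPullback.of_vert_isIso ⟨by simp⟩

lemma star_pullback {X Y X' Y' : C} {x : X ⟶ Y} {x' : X' ⟶ Y'} {a : X' ⟶ X} {b : Y' ⟶ Y}
    (hx : Star S x) (h : IsPullback a x' x b) : Star S x' := by
  obtain ⟨P, Q, y, a', b', hy, h'⟩ := hx
  exact ⟨P, Q, y, a ≫ a', b ≫ b', hy, h.paste_horiz h'⟩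

lemma star_diagonal {E D A : C} {s : D ⟶ A} (hs : S.W s) {u v : E ⟶ D} (h : IsPullback u v s s)
    {d : D ⟶ E} (hu : d ≫ u = 𝟙 D) (hv : d ≫ v = 𝟙 D) : Star S d := by
  refine ⟨D, E, d, 𝟙 D, 𝟙 E, ⟨D, D, D, A, 𝟙 D, 𝟙 D, s, 𝟙 D, 𝟙 D, u, v, S.iso_mem _ inferInstance,
    hs, IsPullback.of_vert_isIso ⟨by simp⟩, by simpa using h, hu, hv⟩,
    IsPullback.of_horiz_isIso ⟨by simp⟩⟩

/-- Horizontal composition of spans, via chosen pullbacks. -/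
noncomputable def SSpan.comp {A B D : C} (p : SSpan S A B) (q : SSpan S B D) : SSpan S A D :=
  haveI := S.hasPullback p.right q.mem
  { apex := pullback p.right q.left
    left := pullback.fst p.right q.left ≫ p.left
    right := pullback.snd p.right q.left ≫ q.right
    mem := S.comp_mem (S.pullback_mem (IsPullback.of_hasPullback p.right q.left) q.mem) p.mem }

/-- The identity span. -/
def SSpan.id (A : C) : SSpan S A A := ⟨A, 𝟙 A, 𝟙 A, S.iso_mem _ inferInstance⟩

lemma SSpan.Le.comp_right {A B D : C} {p p' : SSpan S A B} (h : p.Le p') (q : SSpan S B D) :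
    (p.comp q).Le (p'.comp q) := by
  obtain ⟨x, hx, h1, h2⟩ := h
  have := S.hasPullback p.right q.mem
  have := S.hasPullback p'.right q.mem
  have H := IsPullback.of_hasPullback p.right q.left
  have H' := IsPullback.of_hasPullback p'.right q.left
  have e : (pullback.fst p.right q.left ≫ x) ≫ p'.right = pullback.snd p.right q.left ≫ q.left := by
    rw [Category.assoc, h2, H.w]
  refine ⟨H'.lift _ _ e, ?_, ?_, ?_⟩
  · refine star_pullback (a := pullback.fst p.right q.left) (b := pullback.fst p'.right q.left) hx ?_
    refine (IsPullback.of_right (h₁₂ := pullback.snd p'.right q.left) (h₂₂ := p'.right)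
      (v₁₃ := q.left) ?_ (H'.lift_fst _ _ e) H'.flip).flip
    rw [H'.lift_snd, h2]
    exact H.flip
  · exact (H'.lift_fst_assoc _ _ e p'.left).trans (by rw [Category.assoc, h1]; rfl)
  · exact H'.lift_snd_assoc _ _ e q.right

lemma SSpan.Le.comp_left {A B D : C} (p : SSpan S A B) {q q' : SSpan S B D} (h : q.Le q') :
    (p.comp q).Le (p.comp q') := by
  obtain ⟨x, hx, h1, h2⟩ := h
  have := S.hasPullback p.right q.mem
  have := S.hasPullback p.right q'.mem
  have H := IsPullback.of_hasPullback p.right q.left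
  have H' := IsPullback.of_hasPullback p.right q'.left
  have e : pullback.fst p.right q.left ≫ p.right = (pullback.snd p.right q.left ≫ x) ≫ q'.left := by
    rw [Category.assoc, h1, H.w]
  refine ⟨H'.lift _ _ e, ?_, ?_, ?_⟩
  · refine star_pullback (a := pullback.snd p.right q.left) (b := pullback.snd p.right q'.left) hx ?_
    refine (IsPullback.of_right (h₁₂ := pullback.fst p.right q'.left) (h₂₂ := q'.left)
      (v₁₃ := p.right) ?_ (H'.lift_snd _ _ e) H').flip
    rw [H'.lift_fst, h1]
    exact H
  · exact H'.lift_fst_assoc _ _ e p.left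
  · exact (H'.lift_snd_assoc _ _ e q'.right).trans (by rw [Category.assoc, h2]; rfl)

lemma SSpan.Rel.comp {A B D : C} {p p' : SSpan S A B} {q q' : SSpan S B D} (hp : p.Rel p')
    (hq : q.Rel q') : (p.comp q).Rel (p'.comp q') := by
  refine Relation.EqvGen.trans _ (p'.comp q) _ ?_ ?_
  · induction hp with
    | rel _ _ h => exact .rel _ _ (h.comp_right q)
    | refl _ => exact .refl _
    | symm _ _ _ ih => exact .symm _ _ ih
    | trans _ _ _ _ _ ih ih' => exact .trans _ _ _ ih ih'
  · induction hq with
    | rel _ _ h => exact .rel _ _ (h.comp_left p')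
    | refl _ => exact .refl _
    | symm _ _ _ ih => exact .symm _ _ ih
    | trans _ _ _ _ _ ih ih' => exact .trans _ _ _ ih ih'

/-- The objects of the partial map category `Par(C, S)`: those of `C`. -/
structure Par {C : Type u} [Category.{v} C] (_S : StableClass C) where
  obj : C

noncomputable instance : CategoryStruct.{max u v} (Par S) where
  Hom X Y := Quotient (SSpan.setoid S X.obj Y.obj)
  id X := Quotient.mk _ (SSpan.id X.obj)
  comp f g := Quotient.map₂ SSpan.comp
    (fun (p p' : SSpan S _ _) (h : p.Rel p') (q q' : SSpan S _ _) (h' : q.Rel q') => h.comp h') f g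

/-- The class `[s, f]` of the span `A ←s— D —f→ B`. -/
def par {A B D : C} (s : D ⟶ A) (f : D ⟶ B) (hs : S.W s) : Par.mk (_S := S) A ⟶ Par.mk B :=
  Quotient.mk (SSpan.setoid S A B) ⟨D, s, f, hs⟩

lemma par_eq_of_star {A B D E : C} {s : D ⟶ A} {f : D ⟶ B} {t : E ⟶ A} {g : E ⟶ B} {hs : S.W s}
    {ht : S.W t} (x : D ⟶ E) (hx : Star S x) (h1 : x ≫ t = s) (h2 : x ≫ g = f) :
    par s f hs = par t g ht :=
  Quotient.sound (Relation.EqvGen.rel _ _ ⟨x, hx, h1, h2⟩)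

lemma par_comp {A B D E F P : C} {s : E ⟶ A} {f : E ⟶ B} {t : F ⟶ B} {g : F ⟶ D} {hs : S.W s}
    {ht : S.W t} {a : P ⟶ E} {b : P ⟶ F} (h : IsPullback a b f t) :
    par s f hs ≫ par t g ht =
      par (a ≫ s) (b ≫ g) (S.comp_mem (S.pullback_mem h ht) hs) := by
  have := S.hasPullback f ht
  let H := IsPullback.of_hasPullback f t
  refine par_eq_of_star (H.isoIsPullback _ _ h).hom (star_of_isIso _) ?_ ?_
  · rw [← Category.assoc, IsPullback.isoIsPullback_hom_fst]
  · rw [← Category.assoc, IsPullback.isoIsPullback_hom_snd]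

lemma par_comp_ex {A B E F : C} {s : E ⟶ A} {f : E ⟶ B} {t : F ⟶ B} (_ : S.W s) (ht : S.W t) :
    ∃ (P : C) (a : P ⟶ E) (b : P ⟶ F), IsPullback a b f t :=
  haveI := S.hasPullback f ht
  ⟨_, _, _, IsPullback.of_hasPullback f t⟩

lemma par_ind {X Y : Par S} {motive : (X ⟶ Y) → Prop}
    (h : ∀ (D : C) (s : D ⟶ X.obj) (f : D ⟶ Y.obj) (hs : S.W s), motive (par s f hs))
    (φ : X ⟶ Y) : motive φ := by
  induction φ using Quotient.ind with
  | _ p => exact h _ _ _ p.mem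

lemma id_mem (A : C) : S.W (𝟙 A) := S.iso_mem _ inferInstance

lemma par_id (X : Par S) : 𝟙 X = par (𝟙 X.obj) (𝟙 X.obj) (id_mem _) := rfl

lemma par_congr {A B D : C} {s s' : D ⟶ A} {f f' : D ⟶ B} {hs : S.W s} {hs' : S.W s'}
    (h1 : s = s') (h2 : f = f') : par s f hs = par s' f' hs' := by subst h1 h2; rfl

/-- `Par(C, S)`: composition of spans by pullback, modulo the equivalence relation `Rel`. -/
noncomputable instance : Category.{max u v} (Par S) where
  id_comp := by
    intro X Y φ
    induction φ using par_ind with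
    | _ D s f hs =>
      rw [par_id]
      exact (par_comp (a := s) (b := 𝟙 D) (IsPullback.of_vert_isIso ⟨by simp⟩)).trans
        (par_congr (by simp) (by simp))
  comp_id := by
    intro X Y φ
    induction φ using par_ind with
    | _ D s f hs =>
      rw [par_id]
      exact (par_comp (a := 𝟙 D) (b := f) (IsPullback.of_horiz_isIso ⟨by simp⟩)).trans
        (par_congr (by simp) (by simp))
  assoc := by
    intro X Y Z T φ ψ χ
    induction φ using par_ind with
    | _ D s f hs =>
    induction ψ using par_ind with
    | _ E t g ht =>
    induction χ using par_ind with
    | _ F r h hr =>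
      obtain ⟨P, a, b, H1⟩ := par_comp_ex (f := f) hs ht
      obtain ⟨R, c, d, H2⟩ := par_comp_ex (f := g) ht hr
      obtain ⟨Q, m, n, H3⟩ := par_comp_ex (f := b) (S.pullback_mem H1 ht) (S.pullback_mem H2 hr)
      rw [par_comp H1, par_comp H2, par_comp (H3.flip.paste_horiz H2.flip).flip,
        par_comp (H3.paste_horiz H1)]
      exact par_congr (by simp) (by simp)

end Par

/-- A restriction structure on a category. -/
class RestrictionCategory (X : Type u) [Category.{v} X] where
  rest : ∀ {A B : X}, (A ⟶ B) → (A ⟶ A)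
  rest_comp : ∀ {A B : X} (f : A ⟶ B), rest f ≫ f = f
  rest_comm : ∀ {A B D : X} (f : A ⟶ B) (g : A ⟶ D), rest g ≫ rest f = rest f ≫ rest g
  rest_rest : ∀ {A B D : X} (f : A ⟶ B) (g : A ⟶ D), rest (rest f ≫ g) = rest f ≫ rest g
  comp_rest : ∀ {A B D : X} (f : A ⟶ B) (g : B ⟶ D), f ≫ rest g = rest (f ≫ g) ≫ f

/-- A restriction category in which all restriction idempotents split. -/
class SplitRestrictionCategory (X : Type u) [Category.{v} X] extends RestrictionCategory X where
  split : ∀ {A : X} (e : A ⟶ A), rest e = e →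
    ∃ (B : X) (r : A ⟶ B) (m : B ⟶ A), r ≫ m = e ∧ m ≫ r = 𝟙 B

open RestrictionCategory SplitRestrictionCategory

section ParRestriction

variable {C : Type u} [Category.{v} C] {S : StableClass C}

/-- `[1, s]` is a section, with retraction `[s, 1]`. -/
lemma par_section {A D : C} (s : D ⟶ A) (hs : S.W s) :
    par (𝟙 D) s (id_mem D) ≫ par s (𝟙 D) hs = 𝟙 (Par.mk (_S := S) D) := by
  obtain ⟨P, a, b, H⟩ := par_comp_ex (f := s) (id_mem (S := S) D) hs
  rw [par_comp H, par_id]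
  refine (par_eq_of_star (H.lift (𝟙 D) (𝟙 D) rfl) (star_diagonal hs H (by simp) (by simp))
    (by simp) (by simp)).symm

lemma par_fac {A B D : C} (s : D ⟶ A) (f : D ⟶ B) (hs : S.W s) :
    par s (𝟙 D) hs ≫ par (𝟙 D) f (id_mem D) = par (S := S) s f hs :=
  (par_comp (a := 𝟙 D) (b := 𝟙 D) (IsPullback.of_vert_isIso ⟨by simp⟩)).trans
    (par_congr (by simp) (by simp))

lemma par_comp_total {A B B' D : C} (s : D ⟶ A) (f : D ⟶ B) (g : B ⟶ B') (hs : S.W s) :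
    par s f hs ≫ par (𝟙 B) g (id_mem B) = par (S := S) s (f ≫ g) hs :=
  (par_comp (a := 𝟙 D) (b := f) (IsPullback.of_horiz_isIso ⟨by simp⟩)).trans
    (par_congr (by simp) (by simp))

/-- The restriction operator `[s, f] ↦ [s, s]`. -/
def parRest {X Y : Par S} (φ : X ⟶ Y) : X ⟶ X :=
  Quotient.lift (s := SSpan.setoid S X.obj Y.obj)
    (fun p : SSpan S X.obj Y.obj => (par p.left p.left p.mem : X ⟶ X))
    (fun p q (h : p.Rel q) => by
      induction h with
      | rel _ _ h =>
        obtain ⟨x, hx, h1, -⟩ := h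
        exact par_eq_of_star x hx h1 h1
      | refl _ => rfl
      | symm _ _ _ ih => exact ih.symm
      | trans _ _ _ _ _ ih ih' => exact ih.trans ih') φ

lemma parRest_par {A B D : C} (s : D ⟶ A) (f : D ⟶ B) (hs : S.W s) :
    parRest (par s f hs) = par s s hs := rfl

noncomputable instance : SplitRestrictionCategory (Par S) where
  rest := parRest
  rest_comp := by
    intro X Y φ
    induction φ using par_ind with
    | _ D s f hs =>
      rw [parRest_par, ← par_fac s s hs, ← par_fac s f hs, Category.assoc,
        ← Category.assoc (par (𝟙 D) s _), par_section, Category.id_comp]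
  rest_comm := by
    intro X Y Z φ ψ
    induction φ using par_ind with
    | _ D s f hs =>
    induction ψ using par_ind with
    | _ E t g ht =>
      obtain ⟨P, a, b, H⟩ := par_comp_ex (f := s) hs ht
      rw [parRest_par, parRest_par, par_comp H, par_comp H.flip]
      exact par_congr H.w.symm H.w
  rest_rest := by
    intro X Y Z φ ψ
    induction φ using par_ind with
    | _ D s f hs =>
    induction ψ using par_ind with
    | _ E t g ht =>
      obtain ⟨P, a, b, H⟩ := par_comp_ex (f := s) hs ht
      rw [parRest_par, parRest_par, par_comp H, par_comp H, parRest_par]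
      exact par_congr rfl H.w
  comp_rest := by
    intro X Y Z φ ψ
    induction φ using par_ind with
    | _ D s f hs =>
    induction ψ using par_ind with
    | _ E t g ht =>
      obtain ⟨P, a, b, H⟩ := par_comp_ex (f := f) hs ht
      have ha := S.pullback_mem H ht
      rw [parRest_par, par_comp H, par_comp H, parRest_par,
        ← par_comp_total _ a s (S.comp_mem ha hs), Category.assoc, ← par_fac s f hs,
        ← Category.assoc (par (𝟙 D) s _), par_section, Category.id_comp, par_comp_total]
      exact par_congr rfl H.w.symm
  split := by
    intro X e
    induction e using par_ind with
    | _ D s f hs =>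
      intro he
      refine ⟨Par.mk D, par s (𝟙 D) hs, par (𝟙 D) s (id_mem D), ?_, par_section s hs⟩
      rw [par_fac]
      exact he

end ParRestriction

section Total

variable {X : Type u} [Category.{v} X]

section

variable [RestrictionCategory X]

lemma rest_eq_id_of_mono {A B : X} (f : A ⟶ B) [Mono f] : rest f = 𝟙 A := by
  rw [← cancel_mono f, rest_comp, Category.id_comp]

lemma rest_comp_rest {A B D : X} (f : A ⟶ B) (g : B ⟶ D) : rest (f ≫ rest g) = rest (f ≫ g) := by
  have h : rest (rest (f ≫ g) ≫ f) = rest (f ≫ g) ≫ rest f := rest_rest _ _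
  have h' : rest f ≫ rest (f ≫ g) = rest (f ≫ g) := by
    rw [← rest_rest, ← Category.assoc, rest_comp]
  rw [comp_rest, h, rest_comm, h']

lemma rest_rest_comp {A B D : X} (f : A ⟶ B) (g : B ⟶ D) :
    rest (f ≫ g) ≫ rest f = rest (f ≫ g) := by
  rw [rest_comm, ← rest_rest, ← Category.assoc, rest_comp]

lemma rest_comp_total {A B D : X} (f : A ⟶ B) (g : B ⟶ D) (hg : rest g = 𝟙 B) :
    rest (f ≫ g) = rest f := by
  rw [← rest_comp_rest, hg, Category.comp_id]

lemma rest_left {A B D : X} (f : A ⟶ B) (g : B ⟶ D) (h : rest (f ≫ g) = 𝟙 A) :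
    rest f = 𝟙 A := by
  have h' := rest_rest_comp f g
  rwa [h, Category.id_comp] at h'

variable (X) in
/-- The total morphisms: those with `rest f = 1`. -/
def totalMor : MorphismProperty X := fun A _ f => rest f = 𝟙 A

instance : (totalMor X).IsMultiplicative where
  id_mem A := rest_eq_id_of_mono (𝟙 A)
  comp_mem f g hf hg := (rest_comp_total f g hg).trans hf

variable (X) in
/-- The category of total morphisms. -/
abbrev Total := WideSubcategory (totalMor X)

/-- `j` is a restricted inverse of `i`. -/
def IsRestrictedInverse {A B : X} (i : A ⟶ B) (j : B ⟶ A) : Prop :=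
  i ≫ j = rest i ∧ j ≫ i = rest j

variable (X) in
/-- The class of total restricted isomorphisms. -/
def reIso : MorphismProperty (Total X) := fun _ _ i => ∃ j, IsRestrictedInverse i.hom j

lemma isPullback_of_split {P A D B : Total X} {m : P ⟶ A} {k : P ⟶ D} {f : A ⟶ B} {i : D ⟶ B}
    {j : B.obj ⟶ D.obj} (hj : IsRestrictedInverse i.hom j) (w : m ≫ f = k ≫ i)
    {r : A.obj ⟶ P.obj} (h1 : r ≫ m.hom = rest (f.hom ≫ j)) (h2 : m.hom ≫ r = 𝟙 _) :
    IsPullback m k f i := by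
  have hi : i.hom ≫ j = 𝟙 _ := hj.1.trans i.property
  have wX : m.hom ≫ f.hom = k.hom ≫ i.hom := congrArg (·.hom) w
  have hk : m.hom ≫ f.hom ≫ j = k.hom := by rw [← Category.assoc, wX, Category.assoc, hi]; simp
  have key : ∀ s : PullbackCone f i, (s.fst.hom ≫ r) ≫ m.hom = s.fst.hom := by
    intro s
    have ws : s.fst.hom ≫ f.hom = s.snd.hom ≫ i.hom := congrArg (·.hom) s.condition
    have : s.fst.hom ≫ f.hom ≫ j = s.snd.hom := by
      rw [← Category.assoc, ws, Category.assoc, hi]; simp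
    rw [Category.assoc, h1, comp_rest, this, show rest s.snd.hom = 𝟙 _ from s.snd.property,
      Category.id_comp]
  refine IsPullback.of_isLimit' ⟨w⟩ (PullbackCone.IsLimit.mk w (fun s => ⟨s.fst.hom ≫ r, ?_⟩)
    ?_ ?_ ?_)
  · refine rest_left _ m.hom ?_
    rw [key]
    exact s.fst.property
  · intro s
    exact WideSubcategory.hom_ext _ (key s)
  · intro s
    refine WideSubcategory.hom_ext _ ?_
    have ws : s.fst.hom ≫ f.hom = s.snd.hom ≫ i.hom := congrArg (·.hom) s.condition
    show (s.fst.hom ≫ r) ≫ k.hom = s.snd.hom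
    rw [← hk, ← Category.assoc, key, ← Category.assoc, ws, Category.assoc, hi]
    simp
  · intro s l hl _
    refine WideSubcategory.hom_ext _ ?_
    have : l.hom ≫ m.hom = s.fst.hom := congrArg (·.hom) hl
    show l.hom = s.fst.hom ≫ r
    rw [← this, Category.assoc, h2]
    simp

end

variable [SplitRestrictionCategory X]

lemma exists_isPullback_reIso {A D B : Total X} (f : A ⟶ B) {i : D ⟶ B} (hi : reIso X i) :
    ∃ (P : Total X) (m : P ⟶ A) (k : P ⟶ D) (j : B.obj ⟶ D.obj) (r : A.obj ⟶ P.obj),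
      reIso X m ∧ m ≫ f = k ≫ i ∧ IsRestrictedInverse i.hom j ∧
        r ≫ m.hom = rest (f.hom ≫ j) ∧ m.hom ≫ r = 𝟙 _ := by
  obtain ⟨j, hj⟩ := hi
  obtain ⟨P, r, m, h1, h2⟩ := split (rest (f.hom ≫ j))
    (by simpa [rest_eq_id_of_mono] using rest_rest (f.hom ≫ j) (𝟙 _))
  have hm : rest m = 𝟙 P := rest_left m r (by rw [h2]; exact rest_eq_id_of_mono _)
  have hme : m ≫ rest (f.hom ≫ j) = m := by rw [← h1, ← Category.assoc, h2, Category.id_comp]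
  have hk : rest (m ≫ f.hom ≫ j) = 𝟙 P := by
    have := hme
    rw [comp_rest] at this
    have h := congrArg (· ≫ r) this
    simpa only [Category.assoc, h2, Category.comp_id] using h
  have hr : rest r = rest (f.hom ≫ j) := by
    rw [← rest_comp_total r m hm, h1]
    simpa [rest_eq_id_of_mono] using rest_rest (f.hom ≫ j) (𝟙 _)
  refine ⟨⟨P⟩, ⟨m, hm⟩, ⟨m ≫ f.hom ≫ j, hk⟩, j, r, ⟨r, ?_, ?_⟩, ?_, hj, h1, h2⟩
  · exact h2.trans hm.symm
  · exact h1.trans hr.symm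
  · refine WideSubcategory.hom_ext _ ?_
    show m ≫ f.hom = (m ≫ f.hom ≫ j) ≫ i.hom
    simp only [Category.assoc]
    rw [hj.2, comp_rest, ← Category.assoc, comp_rest, hk, Category.id_comp]

lemma IsRestrictedInverse.comp {A B D : Total X} {f : A ⟶ B} {g : B ⟶ D} {j : B.obj ⟶ A.obj}
    {l : D.obj ⟶ B.obj} (hj : IsRestrictedInverse f.hom j) (hl : IsRestrictedInverse g.hom l) :
    IsRestrictedInverse (f ≫ g).hom (l ≫ j) := by
  have hf1 : f.hom ≫ j = 𝟙 _ := hj.1.trans f.property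
  have hg1 : g.hom ≫ l = 𝟙 _ := hl.1.trans g.property
  refine ⟨?_, ?_⟩
  · refine Eq.trans ?_ (f ≫ g).property.symm
    show (f.hom ≫ g.hom) ≫ l ≫ j = 𝟙 _
    rw [Category.assoc, ← Category.assoc g.hom, hg1, Category.id_comp, hf1]
  · show (l ≫ j) ≫ f.hom ≫ g.hom = _
    rw [Category.assoc, ← Category.assoc j, hj.2, ← Category.assoc, comp_rest, Category.assoc, hl.2,
      rest_rest_comp]

lemma reIso_comp {A B D : Total X} {f : A ⟶ B} {g : B ⟶ D} (hf : reIso X f) (hg : reIso X g) :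
    reIso X (f ≫ g) :=
  let ⟨_, hj⟩ := hf
  let ⟨_, hl⟩ := hg
  ⟨_, hj.comp hl⟩

lemma isRestrictedInverse_of_iso {A B : Total X} (f : A ≅ B) :
    IsRestrictedInverse f.hom.hom f.inv.hom :=
  ⟨(congrArg (·.hom) f.hom_inv_id).trans f.hom.property.symm,
    (congrArg (·.hom) f.inv_hom_id).trans f.inv.property.symm⟩

lemma reIso_of_isIso {A B : Total X} (f : A ⟶ B) [IsIso f] : reIso X f :=
  ⟨_, isRestrictedInverse_of_iso (asIso f)⟩

variable (X) in
/-- The stable class of total restricted isomorphisms in the category of total morphisms. -/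
def reIsoClass : StableClass (Total X) where
  W := reIso X
  iso_mem f _ := reIso_of_isIso f
  comp_mem := reIso_comp
  hasPullback f _ hs := by
    obtain ⟨P, m, k, j, r, _, w, hj, h1, h2⟩ := exists_isPullback_reIso f hs
    exact (isPullback_of_split hj w h1 h2).hasPullback
  pullback_mem {P A B D s' f' f s} H hs := by
    obtain ⟨Q, m, k, j, r, hm, w, hj, h1, h2⟩ := exists_isPullback_reIso f hs
    have H' := isPullback_of_split hj w h1 h2
    rw [← IsPullback.isoIsPullback_hom_fst _ _ H H']
    exact reIso_comp (reIso_of_isIso _) hm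

end Total

/-- Data specifying a 2-category of categories with structure: each `o : O` has an underlying
category, the 1-cells are the functors satisfying `P₁`, and the 2-cells are the natural
transformations satisfying `P₂`, with the compositions of functors and natural transformations. -/
structure TwoCatData (O : Type u') where
  cat : O → Type u
  [inst : ∀ o, Category.{v} (cat o)]
  P₁ : ∀ (a b : O), (cat a ⥤ cat b) → Prop
  P₂ : ∀ (a b : O) (F G : cat a ⥤ cat b), (F ⟶ G) → Prop
  id₁ : ∀ a, P₁ a a (𝟭 (cat a))
  comp₁ : ∀ {a b c : O} {F : cat a ⥤ cat b} {G : cat b ⥤ cat c}, P₁ a b F → P₁ b c G →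
    P₁ a c (F ⋙ G)
  id₂ : ∀ {a b : O} {F : cat a ⥤ cat b}, P₁ a b F → P₂ a b F F (𝟙 F)
  comp₂ : ∀ {a b : O} {F G H : cat a ⥤ cat b} {α : F ⟶ G} {β : G ⟶ H},
    P₂ a b F G α → P₂ a b G H β → P₂ a b F H (α ≫ β)
  whiskerLeft : ∀ {a b c : O} {F : cat a ⥤ cat b} {G H : cat b ⥤ cat c} {α : G ⟶ H}, P₁ a b F →
    P₂ b c G H α → P₂ a c (F ⋙ G) (F ⋙ H) (F.whiskerLeft α)
  whiskerRight : ∀ {a b c : O} {F G : cat a ⥤ cat b} {H : cat b ⥤ cat c} {α : F ⟶ G},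
    P₁ a b G → P₁ b c H → P₂ a b F G α →
    P₂ a c (F ⋙ H) (G ⋙ H) (Functor.whiskerRight α H)

attribute [instance] TwoCatData.inst

variable {O : Type u'}

/-- The 2-category specified by `D`. -/
structure TwoCat (D : TwoCatData.{v, u} O) where
  obj : O

namespace TwoCat

variable {D : TwoCatData.{v, u} O}

@[ext]
structure Hom₁ (X Y : TwoCat D) where
  functor : D.cat X.obj ⥤ D.cat Y.obj
  prop : D.P₁ X.obj Y.obj functor

@[ext]
structure Hom₂ {X Y : TwoCat D} (F G : Hom₁ X Y) where
  nat : F.functor ⟶ G.functor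
  prop : D.P₂ X.obj Y.obj F.functor G.functor nat

instance : CategoryStruct (TwoCat D) where
  Hom := Hom₁
  id X := ⟨𝟭 _, D.id₁ X.obj⟩
  comp F G := ⟨F.functor ⋙ G.functor, D.comp₁ F.prop G.prop⟩

instance (X Y : TwoCat D) : Category (X ⟶ Y) where
  Hom F G := Hom₂ F G
  id F := ⟨𝟙 F.functor, D.id₂ F.prop⟩
  comp α β := ⟨α.nat ≫ β.nat, D.comp₂ α.prop β.prop⟩
  id_comp α := Hom₂.ext (Category.id_comp α.nat)
  comp_id α := Hom₂.ext (Category.comp_id α.nat)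
  assoc α β γ := Hom₂.ext (Category.assoc α.nat β.nat γ.nat)

lemma ext₂ {X Y : TwoCat D} {F G : X ⟶ Y} {α β : F ⟶ G}
    (h : ∀ x, α.nat.app x = β.nat.app x) : α = β :=
  Hom₂.ext (NatTrans.ext (funext h))

lemma comp_nat {X Y : TwoCat D} {F G H : X ⟶ Y} (α : F ⟶ G) (β : G ⟶ H) :
    (α ≫ β).nat = α.nat ≫ β.nat := rfl

instance : Bicategory (TwoCat D) where
  homCategory X Y := inferInstance
  whiskerLeft F _ _ α := Hom₂.mk (F.functor.whiskerLeft α.nat) (D.whiskerLeft F.prop α.prop)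
  whiskerRight {_ _ _ _ G} α H := Hom₂.mk (Functor.whiskerRight α.nat H.functor)
    (D.whiskerRight G.prop H.prop α.prop)
  associator F G H := Iso.refl (F ≫ G ≫ H)
  leftUnitor F := Iso.refl F
  rightUnitor F := Iso.refl F
  whiskerLeft_id _ _ := by
    apply ext₂; intro x; rfl
  whiskerLeft_comp _ _ _ _ _ _ := by
    apply ext₂; intro x; rfl
  id_whiskerLeft _ := by
    apply ext₂; intro x; exact ((Category.id_comp _).trans (Category.comp_id _)).symm
  comp_whiskerLeft _ _ _ _ _ := by
    apply ext₂; intro x; exact ((Category.id_comp _).trans (Category.comp_id _)).symm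
  id_whiskerRight F G := by
    apply ext₂; intro x; exact G.functor.map_id _
  comp_whiskerRight α β G := by
    apply ext₂; intro x; exact G.functor.map_comp _ _
  whiskerRight_id _ := by
    apply ext₂; intro x; exact ((Category.id_comp _).trans (Category.comp_id _)).symm
  whiskerRight_comp _ _ _ := by
    apply ext₂; intro x; exact ((Category.id_comp _).trans (Category.comp_id _)).symm
  whisker_assoc _ _ _ _ _ := by
    apply ext₂; intro x; exact ((Category.id_comp _).trans (Category.comp_id _)).symm
  whisker_exchange η θ := by
    apply ext₂; intro x; exact (θ.nat.naturality (η.nat.app x)).symm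
  pentagon F G H I := by
    apply ext₂; intro x
    exact (congrArg (_ ≫ ·) (Category.comp_id _)).trans (congrArg (· ≫ _)
      (I.functor.map_id _))
  triangle F G := by
    apply ext₂; intro x
    exact (Category.id_comp _).trans (G.functor.map_id _).symm

instance : Bicategory.Strict (TwoCat D) where
  id_comp _ := rfl
  comp_id _ := rfl
  assoc _ _ _ := rfl
  leftUnitor_eqToIso _ := rfl
  rightUnitor_eqToIso _ := rfl
  associator_eqToIso _ _ _ := rfl

end TwoCat

/-- The data of the full sub-2-category determined by a map `f` into the objects. -/
abbrev TwoCatData.full (D : TwoCatData.{v, u} O) {O' : Type v'} (f : O' → O) :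
    TwoCatData.{v, u} O' where
  cat a := D.cat (f a)
  P₁ a b := D.P₁ (f a) (f b)
  P₂ a b := D.P₂ (f a) (f b)
  id₁ _ := D.id₁ _
  comp₁ := D.comp₁
  id₂ := D.id₂
  comp₂ := D.comp₂
  whiskerLeft := D.whiskerLeft
  whiskerRight := D.whiskerRight

section Functors

variable {C : Type u} [Category.{v} C] {D : Type u} [Category.{v} D]

/-- Functors mapping `S` into `T` and preserving pullbacks along morphisms of `S`. -/
structure IsStableFunctor (S : StableClass C) (T : StableClass D) (F : C ⥤ D) : Prop where
  map_mem : ∀ {A B : C} {s : A ⟶ B}, S.W s → T.W (F.map s)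
  map_isPullback : ∀ {P A E B : C} {s' : P ⟶ A} {f' : P ⟶ E} {f : A ⟶ B} {s : E ⟶ B},
    S.W s → IsPullback s' f' f s → IsPullback (F.map s') (F.map f') (F.map f) (F.map s)

/-- Natural transformations whose naturality squares at morphisms of `S` are pullback squares. -/
def IsStableNat (S : StableClass C) {F G : C ⥤ D} (α : F ⟶ G) : Prop :=
  ∀ {E A : C} {s : E ⟶ A}, S.W s → IsPullback (F.map s) (α.app E) (α.app A) (G.map s)

variable {S : StableClass C} {T : StableClass D} {F : C ⥤ D}

/-- The image of an `S`-span. -/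
def SSpan.map (hF : IsStableFunctor S T F) {A B : C} (p : SSpan S A B) :
    SSpan T (F.obj A) (F.obj B) :=
  ⟨F.obj p.apex, F.map p.left, F.map p.right, hF.map_mem p.mem⟩

variable (S T F) in
/-- A stable functor (one mapping `S` into `T` and preserving pullbacks along `S`) for which the assignment `[s, f] ↦ [F s, F f]` is well defined. -/
structure IsConsistentFunctor : Prop extends IsStableFunctor S T F where
  map_rel : ∀ {A B : C} (p q : SSpan S A B), p.Rel q →
    (p.map toIsStableFunctor).Rel (q.map toIsStableFunctor)

lemma IsStableFunctor.id : IsStableFunctor S S (𝟭 C) := ⟨fun h => h, fun _ h => h⟩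

lemma IsStableFunctor.comp {E : Type u} [Category.{v} E] {U : StableClass E} {G : D ⥤ E}
    (hF : IsStableFunctor S T F) (hG : IsStableFunctor T U G) : IsStableFunctor S U (F ⋙ G) :=
  ⟨fun h => hG.map_mem (hF.map_mem h),
    fun h h' => hG.map_isPullback (hF.map_mem h) (hF.map_isPullback h h')⟩

lemma IsConsistentFunctor.id : IsConsistentFunctor S S (𝟭 C) := ⟨.id, fun _ _ h => h⟩

lemma IsConsistentFunctor.comp {E : Type u} [Category.{v} E] {U : StableClass E} {G : D ⥤ E}
    (hF : IsConsistentFunctor S T F) (hG : IsConsistentFunctor T U G) :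
    IsConsistentFunctor S U (F ⋙ G) :=
  ⟨hF.toIsStableFunctor.comp hG.toIsStableFunctor,
    fun p q h => hG.map_rel _ _ (hF.map_rel p q h)⟩

/-- The functor `Par(F) : [s, f] ↦ [F s, F f]`. -/
noncomputable def parFunctor (hF : IsConsistentFunctor S T F) : Par S ⥤ Par T where
  obj X := ⟨F.obj X.obj⟩
  map {X Y} φ := Quotient.map (sa := SSpan.setoid S X.obj Y.obj)
    (sb := SSpan.setoid T (F.obj X.obj) (F.obj Y.obj))
    (SSpan.map hF.toIsStableFunctor) hF.map_rel φ
  map_id X := par_congr (F.map_id _) (F.map_id _)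
  map_comp {X Y Z} φ ψ := by
    induction φ using par_ind with
    | _ E s f hs =>
    induction ψ using par_ind with
    | _ E' t g ht =>
      obtain ⟨P, a, b, H⟩ := par_comp_ex (f := f) hs ht
      rw [par_comp H]
      exact (par_congr (F.map_comp _ _) (F.map_comp _ _)).trans
        (par_comp (hs := hF.map_mem hs) (hF.map_isPullback ht H)).symm

lemma parFunctor_map_par (hF : IsConsistentFunctor S T F) {A B E : C} (s : E ⟶ A) (f : E ⟶ B)
    (hs : S.W s) :
    (parFunctor hF).map (par s f hs) = par (F.map s) (F.map f) (hF.map_mem hs) := rfl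

/-- The natural transformation with components `[1, α_A]`. -/
noncomputable def parNat {G : C ⥤ D} (hF : IsConsistentFunctor S T F)
    (hG : IsConsistentFunctor S T G) (α : F ⟶ G) (hα : IsStableNat S α) :
    parFunctor hF ⟶ parFunctor hG where
  app X := par (𝟙 _) (α.app X.obj) (id_mem _)
  naturality X Y φ := by
    induction φ using par_ind with
    | _ E s f hs =>
      exact (par_comp_total _ _ _ (hF.map_mem hs)).trans ((par_congr (by simp) (by simp)).trans
        (par_comp (hs := id_mem _) (ht := hG.map_mem hs) (hα hs)).symm)

/-- Functors preserving the restriction operator. -/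
def IsRestrictionFunctor {X Y : Type u} [Category.{v} X] [Category.{v} Y] [RestrictionCategory X]
    [RestrictionCategory Y] (F : X ⥤ Y) : Prop :=
  ∀ {A B : X} (f : A ⟶ B), F.map (rest f) = rest (F.map f)

/-- Natural transformations with total components. -/
def IsTotalNat {X Y : Type u} [Category.{v} X] [Category.{v} Y] [RestrictionCategory Y]
    {F G : X ⥤ Y} (α : F ⟶ G) : Prop :=
  ∀ A : X, rest (α.app A) = 𝟙 (F.obj A)

lemma parFunctor_isRestriction (hF : IsConsistentFunctor S T F) :
    IsRestrictionFunctor (parFunctor hF) := by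
  intro X Y φ
  induction φ using par_ind with
  | _ E s f hs => rfl

section TotalFunctor

variable {X Y : Type u} [Category.{v} X] [Category.{v} Y]

section
variable [RestrictionCategory X] [RestrictionCategory Y] {F G : X ⥤ Y}

lemma rest_map (hF : IsRestrictionFunctor F) {A B : X} {f : A ⟶ B} (hf : rest f = 𝟙 A) :
    rest (F.map f) = 𝟙 (F.obj A) := by
  rw [← hF, hf, F.map_id]

/-- The functor induced on total morphisms. -/
def totalFunctor (hF : IsRestrictionFunctor F) : Total X ⥤ Total Y where
  obj A := ⟨F.obj A.obj⟩
  map f := ⟨F.map f.hom, rest_map hF f.property⟩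
  map_id A := WideSubcategory.hom_ext _ (F.map_id A.obj)
  map_comp f g := WideSubcategory.hom_ext _ (F.map_comp f.hom g.hom)

/-- The natural transformation induced on total morphisms. -/
def totalNat (hF : IsRestrictionFunctor F) (hG : IsRestrictionFunctor G) (α : F ⟶ G)
    (hα : IsTotalNat α) : totalFunctor hF ⟶ totalFunctor hG where
  app A := ⟨α.app A.obj, hα A.obj⟩
  naturality _ _ f := WideSubcategory.hom_ext _ (α.naturality f.hom)

lemma IsRestrictedInverse.map (hF : IsRestrictionFunctor F) {A B : X} {i : A ⟶ B} {j : B ⟶ A}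
    (h : IsRestrictedInverse i j) : IsRestrictedInverse (F.map i) (F.map j) :=
  ⟨by rw [← F.map_comp, h.1, hF], by rw [← F.map_comp, h.2, hF]⟩
end

variable [SplitRestrictionCategory X] [SplitRestrictionCategory Y] {F G : X ⥤ Y}

lemma totalFunctor_isStable (hF : IsRestrictionFunctor F) :
    IsStableFunctor (reIsoClass X) (reIsoClass Y) (totalFunctor hF) where
  map_mem := fun ⟨j, hj⟩ => ⟨F.map j, hj.map hF⟩
  map_isPullback {P A E B s' f' f s} hs H := by
    obtain ⟨Q, m, k, j, r, hm, w, hj, h1, h2⟩ := exists_isPullback_reIso f hs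
    have H' := isPullback_of_split hj w h1 h2
    refine IsPullback.of_iso (isPullback_of_split (m := (totalFunctor hF).map m)
      (k := (totalFunctor hF).map k) (f := (totalFunctor hF).map f) (i := (totalFunctor hF).map s)
      (j := F.map j) (r := F.map r) (hj.map hF) ?_ ?_ ?_)
      ((totalFunctor hF).mapIso (H'.isoIsPullback _ _ H)) (Iso.refl _) (Iso.refl _) (Iso.refl _)
      ?_ ?_ ?_ ?_
    · rw [← Functor.map_comp, w, Functor.map_comp]
    · show F.map r ≫ F.map m.hom = rest (F.map f.hom ≫ F.map j)
      rw [← F.map_comp, h1, hF, F.map_comp]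
    · show F.map m.hom ≫ F.map r = _
      rw [← F.map_comp, h2, F.map_id]; rfl
    · rw [Functor.mapIso_hom, ← Functor.map_comp, IsPullback.isoIsPullback_hom_fst]; simp
    · rw [Functor.mapIso_hom, ← Functor.map_comp, IsPullback.isoIsPullback_hom_snd]; simp
    · simp
    · simp

lemma totalNat_isStable (hF : IsRestrictionFunctor F) (hG : IsRestrictionFunctor G) (α : F ⟶ G)
    (hα : IsTotalNat α) : IsStableNat (reIsoClass X) (totalNat hF hG α hα) := by
  intro E A s hs
  obtain ⟨j, hj⟩ := hs
  have hs1 : F.map s.hom ≫ F.map j = 𝟙 _ := by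
    rw [← F.map_comp, hj.1, show rest s.hom = 𝟙 _ from s.property, F.map_id]
  refine isPullback_of_split (j := G.map j) (r := F.map j) (hj.map hG) ?_ ?_ ?_
  · exact (totalNat hF hG α hα).naturality s
  · show F.map j ≫ F.map s.hom = rest (α.app A.obj ≫ G.map j)
    rw [← α.naturality, rest_comp_total _ _ (hα _)]
    exact (hj.map hF).2
  · exact hs1

end TotalFunctor

end Functors


section Mono

variable {C : Type u} [Category.{v} C]

/-- All members of `S` are monomorphisms. -/
def StableClass.IsMono (S : StableClass C) : Prop := ∀ ⦃A B : C⦄ (s : A ⟶ B), S.W s → Mono s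

lemma Star.isIso {S : StableClass C} (hS : S.IsMono) {X Y : C} {x : X ⟶ Y} (hx : Star S x) :
    IsIso x := by
  obtain ⟨P, Q, y, a, b, ⟨A, E, B, B', f, s, v, s', f', t', g', _, hv, H, H', h1, h2⟩, K⟩ := hx
  have := hS v hv
  have w : t' ≫ f = g' ≫ s := by
    rw [← cancel_mono v, Category.assoc, H'.w, Category.assoc]
  have hy : IsIso y := by
    refine ⟨H.lift t' g' w, H.hom_ext ?_ ?_, H'.hom_ext ?_ ?_⟩ <;> simp [h1, h2]
  exact K.isIso_snd_of_isIso

lemma SSpan.Rel.isIsomorphic {S : StableClass C} (hS : S.IsMono) {A B : C} {p q : SSpan S A B}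
    (h : p.Rel q) : p.IsIsomorphic q := by
  induction h with
  | rel _ _ h =>
    obtain ⟨x, hx, h1, h2⟩ := h
    have := hx.isIso hS
    exact ⟨asIso x, h1, h2⟩
  | refl _ => exact ⟨Iso.refl _, by simp, by simp⟩
  | symm _ _ _ ih =>
    obtain ⟨x, h1, h2⟩ := ih
    exact ⟨x.symm, by simp [← h1], by simp [← h2]⟩
  | trans _ _ _ _ _ ih ih' =>
    obtain ⟨x, h1, h2⟩ := ih
    obtain ⟨y, h3, h4⟩ := ih'
    exact ⟨x ≪≫ y, by simp [h3, h1], by simp [h4, h2]⟩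

lemma IsStableFunctor.isConsistent {D : Type u} [Category.{v} D] {S : StableClass C}
    {T : StableClass D} {F : C ⥤ D} (hF : IsStableFunctor S T F) (hS : S.IsMono) :
    IsConsistentFunctor S T F := by
  refine ⟨hF, fun p q h => ?_⟩
  obtain ⟨x, h1, h2⟩ := h.isIsomorphic hS
  refine .rel _ _ ⟨F.map x.hom, star_of_isIso (F.map x.hom), ?_, ?_⟩
  · exact (F.map_comp _ _).symm.trans (congrArg F.map h1)
  · exact (F.map_comp _ _).symm.trans (congrArg F.map h2)

lemma reIsoClass_isMono {X : Type u} [Category.{v} X] [SplitRestrictionCategory X] :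
    (reIsoClass X).IsMono := by
  rintro A B s ⟨j, hj⟩
  have h : s.hom ≫ j = 𝟙 _ := hj.1.trans s.property
  refine ⟨fun f g w => WideSubcategory.hom_ext _ ?_⟩
  have w' : f.hom ≫ s.hom = g.hom ≫ s.hom := congrArg (·.hom) w
  simpa [h] using congrArg (· ≫ j) w'

end Mono

section StableNat

variable {C D E : Type u} [Category.{v} C] [Category.{v} D] [Category.{v} E] {S : StableClass C}
  {T : StableClass D} {U : StableClass E}

lemma isStableNat_id {F : C ⥤ D} : IsStableNat S (𝟙 F) :=
  fun _ => IsPullback.of_vert_isIso ⟨by simp⟩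

lemma IsStableNat.comp {F G H : C ⥤ D} {α : F ⟶ G} {β : G ⟶ H} (hα : IsStableNat S α)
    (hβ : IsStableNat S β) : IsStableNat S (α ≫ β) :=
  fun hs => (hα hs).paste_vert (hβ hs)

lemma IsStableNat.whiskerLeft {F : C ⥤ D} {G H : D ⥤ E} {α : G ⟶ H} (hF : IsStableFunctor S T F)
    (hα : IsStableNat T α) : IsStableNat S (F.whiskerLeft α) :=
  fun hs => hα (hF.map_mem hs)

lemma IsStableNat.whiskerRight {F G : C ⥤ D} {H : D ⥤ E} {α : F ⟶ G} (hG : IsStableFunctor S T G)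
    (hH : IsStableFunctor T U H) (hα : IsStableNat S α) :
    IsStableNat S (Functor.whiskerRight α H) :=
  fun hs => hH.map_isPullback (hG.map_mem hs) (hα hs)

end StableNat

/-- A stably structured category `(C, S)`: a category with a stable class of morphisms. The homs live
in a universe at least as large as that of the objects, so that `Par(C, S)` is of the same size. -/
structure StableObj : Type (max (u + 1) (w + 1)) where
  carrier : Type u
  [cat : Category.{max u w} carrier]
  S : StableClass carrier

attribute [instance] StableObj.cat

/-- A split restriction category. -/
structure SplitRestObj : Type (max (u + 1) (w + 1)) where
  carrier : Type u
  [cat : Category.{max u w} carrier]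
  [split : SplitRestrictionCategory carrier]

attribute [instance] SplitRestObj.cat SplitRestObj.split

/-- Stably structured categories, functors mapping `S` into `T` and preserving pullbacks along `S`,
and natural transformations whose naturality squares at morphisms of `S` are pullbacks. -/
abbrev stableData : TwoCatData.{max u w, u} StableObj.{w, u} where
  cat a := a.carrier
  P₁ a b F := IsStableFunctor a.S b.S F
  P₂ a _ _ _ α := IsStableNat a.S α
  id₁ _ := .id
  comp₁ hF hG := hF.comp hG
  id₂ _ := isStableNat_id
  comp₂ h h' := h.comp h'
  whiskerLeft hF h := h.whiskerLeft hF
  whiskerRight hG hH h := h.whiskerRight hG hH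

/-- As `stableData`, with the 1-cells `F` for which `[s, f] ↦ [F s, F f]` is well defined. -/
abbrev consistentData : TwoCatData.{max u w, u} StableObj.{w, u} where
  cat a := a.carrier
  P₁ a b F := IsConsistentFunctor a.S b.S F
  P₂ a _ _ _ α := IsStableNat a.S α
  id₁ _ := .id
  comp₁ hF hG := hF.comp hG
  id₂ _ := isStableNat_id
  comp₂ h h' := h.comp h'
  whiskerLeft hF h := h.whiskerLeft hF.toIsStableFunctor
  whiskerRight hG hH h := h.whiskerRight hG.toIsStableFunctor hH.toIsStableFunctor

/-- Split restriction categories, restriction-preserving functors, total natural transformations. -/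
abbrev splitRestData : TwoCatData.{max u w, u} SplitRestObj.{w, u} where
  cat a := a.carrier
  P₁ _ _ F := IsRestrictionFunctor F
  P₂ _ _ _ _ α := IsTotalNat α
  id₁ _ _ _ _ := rfl
  comp₁ hF hG _ _ f := (congrArg _ (hF f)).trans (hG _)
  id₂ _ _ := rest_eq_id_of_mono _
  comp₂ h h' A := (rest_comp_total _ _ (h' A)).trans (h A)
  whiskerLeft _ h _ := h _
  whiskerRight _ hH h A := rest_map hH (h A)

/-- The 2-category of stably structured categories. -/
abbrev StableCat := TwoCat stableData.{w, u}
/-- The locally full sub-2-category of `StableCat` with the same objects, on those 1-cells `F` for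
which `[s, f] ↦ [F s, F f]` is well defined. -/
abbrev ConsistentStableCat := TwoCat consistentData.{w, u}
/-- The full sub-2-category of `StableCat` on those `(C, S)` with `S` a class of monomorphisms. -/
abbrev StableCatMono :=
  TwoCat (stableData.{w, u}.full (fun a : {a : StableObj.{w, u} // a.S.IsMono} => a.1))
/-- The 2-category of split restriction categories. -/
abbrev SplitRestCat := TwoCat splitRestData.{w, u}

lemma TwoCat.eqToHom_app {O : Type u'} {D : TwoCatData.{v, u} O} {X Y : TwoCat D} {F G : X ⟶ Y}
    (h : F = G) (x : D.cat X.obj) :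
    (eqToHom h : F ⟶ G).nat.app x = eqToHom (by rw [h]) := by
  subst h; rfl

lemma TwoCat.hom_ext {O : Type u'} {D : TwoCatData.{v, u} O} {X Y : TwoCat D} {F G : X ⟶ Y}
    (h : F.functor = G.functor) : F = G := Hom₁.ext h

open TwoCat

/-- The 2-functor `Total`, sending `X` to its category of total morphisms equipped with the class
of total restricted isomorphisms. -/
def total : StrictPseudofunctor SplitRestCat.{w, u} ConsistentStableCat.{w, u} :=
  StrictPseudofunctor.mk''
    { obj X := ⟨⟨Total X.obj.carrier, reIsoClass X.obj.carrier⟩⟩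
      map F := ⟨totalFunctor F.prop, (totalFunctor_isStable F.prop).isConsistent reIsoClass_isMono⟩
      map₂ {_ _ F G} α := Hom₂.mk (totalNat F.prop G.prop α.nat α.prop)
        (totalNat_isStable F.prop G.prop α.nat α.prop)
      map₂_id _ := rfl
      map₂_comp _ _ := rfl
      map_id _ := rfl
      map_comp _ _ := rfl
      map₂_whisker_left _ _ _ _ := ext₂ fun _ =>
        ((Category.id_comp _).trans (Category.comp_id _)).symm
      map₂_whisker_right _ _ := ext₂ fun _ =>
        ((Category.id_comp _).trans (Category.comp_id _)).symm }

lemma parFunctor_id {C : Type u} [Category.{v} C] (S : StableClass C) :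
    parFunctor (S := S) (T := S) .id = 𝟭 (Par S) := by
  refine CategoryTheory.Functor.ext (fun _ => rfl) fun X Y φ => ?_
  induction φ using par_ind with
  | _ E s f hs => exact ((Category.id_comp _).trans (Category.comp_id _)).symm

lemma parFunctor_comp {C D E : Type u} [Category.{v} C] [Category.{v} D] [Category.{v} E]
    {S : StableClass C} {T : StableClass D} {U : StableClass E} {F : C ⥤ D} {G : D ⥤ E}
    (hF : IsConsistentFunctor S T F) (hG : IsConsistentFunctor T U G) :
    parFunctor (hF.comp hG) = parFunctor hF ⋙ parFunctor hG := by
  refine CategoryTheory.Functor.ext (fun _ => rfl) fun X Y φ => ?_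
  induction φ using par_ind with
  | _ E s f hs => exact ((Category.id_comp _).trans (Category.comp_id _)).symm

lemma TwoCat.eq_conj {O : Type u'} {D : TwoCatData.{v, u} O} {X Y : TwoCat D} {F G F' G' : X ⟶ Y}
    (h : F = F') (h' : G' = G) (α : F ⟶ G) (β : F' ⟶ G')
    (e : ∀ x, α.nat.app x ≍ β.nat.app x) : α = eqToHom h ≫ β ≫ eqToHom h' := by
  subst h h'
  simpa using ext₂ fun x => eq_of_heq (e x)

/-- The 2-functor `Par`, sending `F` to `[s, f] ↦ [F s, F f]` and `α` to `[1, α]`. -/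
noncomputable def parTwo : StrictPseudofunctor ConsistentStableCat.{w, u} SplitRestCat.{w, u} :=
  StrictPseudofunctor.mk''
    { obj X := ⟨⟨Par X.obj.S⟩⟩
      map F := ⟨parFunctor F.prop, parFunctor_isRestriction F.prop⟩
      map₂ {_ _ F G} α := Hom₂.mk (parNat F.prop G.prop α.nat α.prop) (fun _ => rfl)
      map₂_id _ := rfl
      map₂_comp _ _ := ext₂ fun _ => (par_comp_total _ _ _ _).symm
      map_id X := TwoCat.hom_ext (parFunctor_id X.obj.S)
      map_comp F G := TwoCat.hom_ext (parFunctor_comp F.prop G.prop)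
      map₂_whisker_left _ _ _ _ := TwoCat.eq_conj _ _ _ _ fun _ => HEq.rfl
      map₂_whisker_right _ G := TwoCat.eq_conj _ _ _ _ fun _ =>
        heq_of_eq (par_congr (G.functor.map_id _).symm rfl) }

/-- The inclusion of `ConsistentStableCat` in `StableCat`. -/
def consistentIncl : StrictPseudofunctor ConsistentStableCat.{w, u} StableCat.{w, u} :=
  StrictPseudofunctor.mk''
    { obj X := ⟨X.obj⟩
      map F := ⟨F.functor, F.prop.toIsStableFunctor⟩
      map₂ α := Hom₂.mk α.nat α.prop
      map₂_id _ := rfl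
      map₂_comp _ _ := rfl
      map_id _ := rfl
      map_comp _ _ := rfl
      map₂_whisker_left _ _ _ _ := TwoCat.eq_conj _ _ _ _ fun _ => HEq.rfl
      map₂_whisker_right _ _ := TwoCat.eq_conj _ _ _ _ fun _ => HEq.rfl }

/-- The inclusion of `StableCatMono` in `ConsistentStableCat`. -/
def monoIncl : StrictPseudofunctor StableCatMono.{w, u} ConsistentStableCat.{w, u} :=
  StrictPseudofunctor.mk''
    { obj X := ⟨X.obj.1⟩
      map {X _} F := ⟨F.functor, F.prop.isConsistent X.obj.2⟩
      map₂ α := Hom₂.mk α.nat α.prop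
      map₂_id _ := rfl
      map₂_comp _ _ := rfl
      map_id _ := rfl
      map_comp _ _ := rfl
      map₂_whisker_left _ _ _ _ := TwoCat.eq_conj _ _ _ _ fun _ => HEq.rfl
      map₂_whisker_right _ _ := TwoCat.eq_conj _ _ _ _ fun _ => HEq.rfl }

/-- The restriction of `Par` to `StableCatMono`. -/
noncomputable def parMono : StrictPseudofunctor StableCatMono.{w, u} SplitRestCat.{w, u} :=
  monoIncl.comp parTwo

/-- The corestriction of `Total` to `StableCatMono`. -/
def totalMono : StrictPseudofunctor SplitRestCat.{w, u} StableCatMono.{w, u} :=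
  StrictPseudofunctor.mk''
    { obj X := ⟨⟨(total.obj X).obj, reIsoClass_isMono⟩⟩
      map F := ⟨(total.map F).functor, (total.map F).prop.toIsStableFunctor⟩
      map₂ α := Hom₂.mk (total.map₂ α).nat (total.map₂ α).prop
      map₂_id _ := rfl
      map₂_comp _ _ := rfl
      map_id _ := rfl
      map_comp _ _ := rfl
      map₂_whisker_left _ _ _ _ := TwoCat.eq_conj _ _ _ _ fun _ => HEq.rfl
      map₂_whisker_right _ _ := TwoCat.eq_conj _ _ _ _ fun _ => HEq.rfl }

section TwoAdjunction

variable {B : Type u} [Bicategory.{w, v} B] {B' : Type u'} [Bicategory.{w, v'} B']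

/-- A (strict) 2-natural transformation between 2-functors. The terms `eqToHom` only transport along
the equality of 1-cells `naturality`. -/
structure TwoNatTrans (F G : StrictPseudofunctor B B') where
  app : ∀ X : B, F.obj X ⟶ G.obj X
  naturality : ∀ {X Y : B} (f : X ⟶ Y), F.map f ≫ app Y = app X ≫ G.map f
  naturality₂ : ∀ {X Y : B} {f g : X ⟶ Y} (α : f ⟶ g),
    F.map₂ α ▷ app Y ≫ eqToHom (naturality g) = eqToHom (naturality f) ≫ app X ◁ G.map₂ α

/-- A 2-adjunction `F ⊣ G`, given by 2-natural unit and counit satisfying the triangle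
identities. -/
structure TwoAdjunction (F : StrictPseudofunctor B B') (G : StrictPseudofunctor B' B) where
  unit : TwoNatTrans (StrictPseudofunctor.id B) (F.comp G)
  counit : TwoNatTrans (G.comp F) (StrictPseudofunctor.id B')
  left_triangle : ∀ X : B, F.map (unit.app X) ≫ counit.app (F.obj X) = 𝟙 (F.obj X)
  right_triangle : ∀ Y : B', unit.app (G.obj Y) ≫ G.map (counit.app Y) = 𝟙 (G.obj Y)

/-- `f` is an isomorphism of the underlying category of the 2-category. -/
def IsIsomorphism {X Y : B} (f : X ⟶ Y) : Prop :=
  ∃ g : Y ⟶ X, f ≫ g = 𝟙 X ∧ g ≫ f = 𝟙 Y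

/-- A 2-adjunction is a 2-equivalence if its unit and counit are isomorphisms. -/
def TwoAdjunction.IsTwoEquivalence {F : StrictPseudofunctor B B'} {G : StrictPseudofunctor B' B}
    (adj : TwoAdjunction F G) : Prop :=
  (∀ X : B, IsIsomorphism (adj.unit.app X)) ∧ ∀ Y : B', IsIsomorphism (adj.counit.app Y)

end TwoAdjunction

/-- The functor `f ↦ [1, f]`. -/
noncomputable def etaFunctor {C : Type u} [Category.{v} C] (S : StableClass C) :
    C ⥤ Total (Par S) where
  obj A := ⟨⟨A⟩⟩
  map {A _} f := ⟨par (𝟙 A) f (id_mem A), rfl⟩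
  map_id _ := rfl
  map_comp f g := WideSubcategory.hom_ext _ (par_comp_total _ f g _).symm

section Counit

variable {X : Type u} [Category.{v} X]

lemma IsRestrictedInverse.unique [RestrictionCategory X] {A B : X} {i : A ⟶ B} {j l : B ⟶ A}
    (hi : rest i = 𝟙 A) (hj : IsRestrictedInverse i j) (hl : IsRestrictedInverse i l) : j = l := by
  have hj1 : i ≫ j = 𝟙 A := hj.1.trans hi
  have hl1 : i ≫ l = 𝟙 A := hl.1.trans hi
  have h1 : rest j ≫ rest l = rest j := by
    rw [← hj.2, ← hl.2, Category.assoc, ← Category.assoc i, hl1, Category.id_comp]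
  have h2 : rest l ≫ rest j = rest l := by
    rw [← hj.2, ← hl.2, Category.assoc, ← Category.assoc i, hj1, Category.id_comp]
  have h3 : rest j = rest l := by rw [← h1, rest_comm, h2]
  have h4 : j = rest j ≫ l := by rw [← hj.2, Category.assoc, hl1, Category.comp_id]
  rw [h4, h3, rest_comp]

variable [SplitRestrictionCategory X]

/-- The restricted inverse of a total restricted isomorphism. -/
noncomputable def reInv {A B : Total X} (i : A ⟶ B) (hi : reIso X i) : B.obj ⟶ A.obj := hi.choose

lemma reInv_eq {A B : Total X} {i : A ⟶ B} (hi : reIso X i) {j : B.obj ⟶ A.obj}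
    (hj : IsRestrictedInverse i.hom j) : reInv i hi = j :=
  hi.choose_spec.unique i.property hj

lemma reInv_spec {A B : Total X} {i : A ⟶ B} (hi : reIso X i) :
    IsRestrictedInverse i.hom (reInv i hi) := hi.choose_spec

variable (X) in
/-- The functor `[s, f] ↦ f · s⁻`, where `s⁻` is the restricted inverse of `s`. -/
noncomputable def epsFunctor : Par (reIsoClass X) ⥤ X where
  obj A := A.obj.obj
  map {A B} φ := Quotient.lift (s := SSpan.setoid (reIsoClass X) A.obj B.obj)
    (fun p => reInv p.left p.mem ≫ p.right.hom) (fun p q (h : p.Rel q) => by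
      obtain ⟨x, h1, h2⟩ := h.isIsomorphic reIsoClass_isMono
      have h : reInv p.left p.mem = reInv q.left q.mem ≫ x.inv.hom :=
        reInv_eq _ (h1 ▸ (isRestrictedInverse_of_iso x).comp (reInv_spec q.mem))
      have h3 : p.right.hom = x.hom.hom ≫ q.right.hom := (congrArg (·.hom) h2).symm
      have h4 : x.inv.hom ≫ x.hom.hom = 𝟙 _ := congrArg (·.hom) x.inv_hom_id
      show reInv p.left p.mem ≫ p.right.hom = reInv q.left q.mem ≫ q.right.hom
      rw [h, h3, Category.assoc, ← Category.assoc x.inv.hom, h4, Category.id_comp]) φ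
  map_id A := (congrArg (· ≫ 𝟙 A.obj.obj)
    (reInv_eq _ (isRestrictedInverse_of_iso (Iso.refl A.obj)))).trans (Category.id_comp _)
  map_comp φ ψ := by
    induction φ using par_ind with
    | _ D s f hs =>
    induction ψ using par_ind with
    | _ E t g ht =>
      obtain ⟨P, m, k, j, r, hm, w, hj, h1, h2⟩ := exists_isPullback_reIso f ht
      have hk : m.hom ≫ f.hom ≫ j = k.hom := by
        have wX : m.hom ≫ f.hom = k.hom ≫ t.hom := congrArg (·.hom) w
        rw [← Category.assoc, wX, Category.assoc, hj.1.trans t.property]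
        exact Category.comp_id _
      have hr : IsRestrictedInverse m.hom r := by
        refine ⟨h2.trans m.property.symm, h1.trans ?_⟩
        rw [← rest_comp_total r m.hom m.property, h1]
        simpa [rest_eq_id_of_mono] using (rest_rest (f.hom ≫ j) (𝟙 _)).symm
      rw [par_comp (isPullback_of_split hj w h1 h2)]
      have e : reInv (m ≫ s) (reIso_comp hm hs) = reInv s hs ≫ r :=
        reInv_eq _ (hr.comp (reInv_spec hs))
      show reInv (m ≫ s) _ ≫ k.hom ≫ g.hom = (reInv s hs ≫ f.hom) ≫ reInv t ht ≫ g.hom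
      rw [e, reInv_eq ht hj, ← hk]
      have : r ≫ m.hom ≫ f.hom ≫ j = f.hom ≫ j := by rw [← Category.assoc, h1, rest_comp]
      simp only [Category.assoc] at this ⊢
      rw [reassoc_of% this]

end Counit

end PartialMaps

/-! The relation on spans is coarse enough to make every `s` in `S` a section in `Par(C, S)`: the
composite of `[1, s]` and `[s, 1]` is the kernel pair of `s`, and its diagonal lies in `S⋆`. So `[1,
s]` is a total restricted isomorphism with restricted inverse `[s, 1]`. Pullbacks along such maps in
a category of total morphisms are splittings of restriction idempotents (`isPullback_of_split`),
which gives stability of the unit. Its consistency rests on `exists_iso_of_star`: the `S⋆`-morphisms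
that identify two spans become invertible in `Total(Par(C, S))`, so identified spans have isomorphic
images.

Total restricted isomorphisms are split monic in the ambient restriction category, hence always
monic among total maps. A faithful unit therefore forces `S` to consist of monomorphisms.
Conversely, if `S` is monic, conjugates are invertible and the relation is plain isomorphism of
spans (`par_eq_iff_of_isMono`). Inspecting the isomorphisms then shows that the unit is full,
faithful and reflects membership in `S` (`mem_of_par_inverse`). It does nothing to objects, so its
inverse is strict.

The counit is also bijective on objects. It is full because `f` is recovered from a splitting of
`rest f`, and faithful because two spans with the same image split the same idempotent. The triangle
and naturality identities reduce to the factorization `[s, f] = [s, 1] ≫ [1, f]` and to uniqueness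
of restricted inverses, which restriction functors preserve. -/

namespace PartialMaps

open RestrictionCategory SplitRestrictionCategory TwoCat

/-! ### The unit on morphisms of `S`, on pullbacks and on `S⋆` -/

section EtaFunctor

variable {C : Type u} [Category.{v} C] {S : StableClass C}

lemma isRestrictedInverse_eta {A D : C} (s : D ⟶ A) (hs : S.W s) :
    IsRestrictedInverse ((etaFunctor S).map s).hom (par s (𝟙 D) hs) :=
  ⟨par_section s hs, par_fac s s hs⟩

lemma reIso_eta {A D : C} {s : D ⟶ A} (hs : S.W s) : reIso (Par S) ((etaFunctor S).map s) :=
  ⟨_, isRestrictedInverse_eta s hs⟩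

lemma isPullback_eta {P A D B : C} {s' : P ⟶ A} {f' : P ⟶ D} {f : A ⟶ B} {s : D ⟶ B}
    (hs : S.W s) (H : IsPullback s' f' f s) :
    IsPullback ((etaFunctor S).map s') ((etaFunctor S).map f') ((etaFunctor S).map f)
      ((etaFunctor S).map s) := by
  have hs' := S.pullback_mem H hs
  refine isPullback_of_split (isRestrictedInverse_eta s hs) ?_ (r := par s' (𝟙 P) hs') ?_
    (par_section s' hs')
  · rw [← Functor.map_comp, H.w, Functor.map_comp]
  · refine (par_fac s' s' hs').trans ?_
    -- The given pullback computes this composite, whose restriction `[s', s']` is split by `[s',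
    -- 1]` and `[1, s']`; that is the criterion of `isPullback_of_split`.
    have h : par (𝟙 A) f (id_mem A) ≫ par s (𝟙 D) hs = par (S := S) s' f' hs' :=
      (par_comp H).trans (par_congr (by simp) (by simp))
    exact (congrArg rest h).symm

/-- A morphism `x` in `S⋆` with `x ≫ t` and `t` in `S` becomes invertible in `Par(C, S)`: the
inverse of `[1, x]` is `[1, t] ≫ [x ≫ t, 1]`. -/
lemma exists_iso_of_star {X Y A : C} {x : X ⟶ Y} {t : Y ⟶ A} (hx : Star S x) (ht : S.W t)
    (hxt : S.W (x ≫ t)) :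
    ∃ e : (etaFunctor S).obj X ≅ (etaFunctor S).obj Y, e.hom = (etaFunctor S).map x := by
  have h1 : par (𝟙 X) x (id_mem X) ≫ par (𝟙 Y) t (id_mem Y) ≫ par (x ≫ t) (𝟙 X) hxt =
      𝟙 (Par.mk (_S := S) X) := by
    rw [← Category.assoc, par_comp_total]
    exact par_section _ _
  have h2 : (par (𝟙 Y) t (id_mem Y) ≫ par (x ≫ t) (𝟙 X) hxt) ≫ par (𝟙 X) x (id_mem X) =
      𝟙 (Par.mk (_S := S) Y) := by
    rw [Category.assoc, par_fac, ← par_section t ht]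
    -- The only use of `S⋆`: `x` identifies `[x ≫ t, x]` with `[t, 1]`.
    exact congrArg _ (par_eq_of_star x hx rfl (Category.comp_id x))
  -- The inverse is a first factor of an identity, hence total, so the isomorphism lives in the
  -- category of total morphisms.
  have h3 : rest (par (𝟙 Y) t (id_mem Y) ≫ par (x ≫ t) (𝟙 X) hxt) = 𝟙 (Par.mk (_S := S) Y) :=
    rest_left _ _ ((congrArg rest h2).trans (rest_eq_id_of_mono _))
  exact ⟨⟨(etaFunctor S).map x, ⟨_, h3⟩, WideSubcategory.hom_ext _ h1,
    WideSubcategory.hom_ext _ h2⟩, rfl⟩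

end EtaFunctor

/-! ### The unit as a 1-cell -/

section EtaConsistent

variable {C : Type u} [Category.{max u w} C] {S : StableClass C}

variable (S) in
lemma etaFunctor_isStable :
    IsStableFunctor.{max u w, u} S (reIsoClass (Par S)) (etaFunctor S) :=
  ⟨fun hs => reIso_eta hs, fun hs H => isPullback_eta hs H⟩

variable (S) in
lemma etaFunctor_isConsistent :
    IsConsistentFunctor.{max u w, u} S (reIsoClass (Par S)) (etaFunctor S) := by
  refine ⟨etaFunctor_isStable.{w} S, fun {A B} p q h => ?_⟩
  induction h with
  | rel p q h =>
    obtain ⟨D, s, f, hs⟩ := p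
    obtain ⟨E, t, g, ht⟩ := q
    obtain ⟨x, hx, h1, h2⟩ := h
    dsimp only at x h1 h2
    subst h1 h2
    -- The image of `x` need not be shown to be a pullback of a conjugate: it is invertible, and
    -- isomorphisms lie in every `S⋆`.
    obtain ⟨e, he⟩ := exists_iso_of_star hx ht hs
    refine .rel _ _ ⟨e.hom, star_of_isIso e.hom, ?_, ?_⟩
    · rw [he]; exact ((etaFunctor S).map_comp _ _).symm
    · rw [he]; exact ((etaFunctor S).map_comp _ _).symm
  | refl _ => exact .refl _
  | symm _ _ _ ih => exact .symm _ _ ih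
  | trans _ _ _ _ _ ih ih' => exact .trans _ _ _ ih ih'

end EtaConsistent

/-! ### Full faithfulness of the unit when `S` is monic -/

section EtaInverse

variable {C : Type u} [Category.{v} C] {S : StableClass C}

lemma exists_par_eq {A B : C} (φ : Par.mk (_S := S) A ⟶ Par.mk B) :
    ∃ (D : C) (s : D ⟶ A) (f : D ⟶ B) (hs : S.W s), φ = par s f hs :=
  par_ind (motive := fun φ => ∃ (D : C) (s : D ⟶ A) (f : D ⟶ B) (hs : S.W s), φ = par s f hs)
    (fun D s f hs => ⟨D, s, f, hs, rfl⟩) φ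

/-- For monic `S` every member of `S⋆` is invertible, so the generated equivalence relation is no
coarser than isomorphism. This turns equations in `Par(C, S)` into equations in `C`. -/
lemma par_eq_iff_of_isMono (hS : S.IsMono) {A B D E : C} {s : D ⟶ A} {f : D ⟶ B} {t : E ⟶ A}
    {g : E ⟶ B} {hs : S.W s} {ht : S.W t} :
    par s f hs = par t g ht ↔ ∃ x : D ≅ E, x.hom ≫ t = s ∧ x.hom ≫ g = f := by
  refine ⟨fun h => ?_, fun ⟨x, h1, h2⟩ => par_eq_of_star x.hom (star_of_isIso _) h1 h2⟩
  have h : SSpan.Rel ⟨D, s, f, hs⟩ ⟨E, t, g, ht⟩ :=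
    @Quotient.exact _ (SSpan.setoid S A B) _ _ h
  exact h.isIsomorphic hS

lemma etaFunctor_faithful (hS : S.IsMono) : (etaFunctor S).Faithful where
  map_injective {A B f g} h := by
    obtain ⟨x, h1, h2⟩ := (par_eq_iff_of_isMono hS).1
      (congrArg (·.hom) h : par (𝟙 A) f (id_mem A) = par (𝟙 A) g (id_mem A))
    rw [Category.comp_id] at h1
    rw [← h2, h1, Category.id_comp]

/-- Totality of `[s, f]` says `[s, s] = [1, 1]`, which forces `s` to be invertible; the preimage is
then `f` after the inverse of `s`. -/
lemma etaFunctor_full (hS : S.IsMono) : (etaFunctor S).Full where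
  map_surjective {A B} := by
    rintro ⟨φ, hφ⟩
    obtain ⟨D, s, f, hs, rfl⟩ := exists_par_eq φ
    obtain ⟨x, h1, -⟩ := (par_eq_iff_of_isMono hS).1
      (hφ : par s s hs = par (𝟙 A) (𝟙 A) (id_mem A))
    rw [Category.comp_id] at h1
    refine ⟨x.inv ≫ f, WideSubcategory.hom_ext _ ?_⟩
    exact (par_eq_iff_of_isMono hS).2 ⟨x.symm, (congrArg (x.inv ≫ ·) h1.symm).trans x.inv_hom_id, rfl⟩

/-- Write the restricted inverse as `[t, g]`. The two equations make `g` invertible with `g ≫ f =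
t`, so `f` is an isomorphism followed by a member of `S`. -/
lemma mem_of_par_inverse (hS : S.IsMono) {A B : C} {f : A ⟶ B}
    {φ : Par.mk (_S := S) B ⟶ Par.mk A}
    (h1 : par (𝟙 A) f (id_mem A) ≫ φ = 𝟙 (Par.mk A))
    (h2 : φ ≫ par (𝟙 A) f (id_mem A) = rest φ) : S.W f := by
  obtain ⟨E, t, g, ht, rfl⟩ := exists_par_eq φ
  obtain ⟨x, h3, h4⟩ := (par_eq_iff_of_isMono hS).1
    ((par_comp_total t g f ht).symm.trans h2 : par t (g ≫ f) ht = par t t ht)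
  have := hS t ht
  -- An automorphism over the monomorphism `t` is trivial, so the right legs agree on the nose.
  have hx : x.hom = 𝟙 E := by rw [← cancel_mono t, h3, Category.id_comp]
  have hgf : g ≫ f = t := by rw [← h4, hx, Category.id_comp]
  obtain ⟨P, a, b, H⟩ := par_comp_ex (f := f) (id_mem (S := S) A) ht
  rw [par_comp H] at h1
  obtain ⟨z, h5, h6⟩ := (par_eq_iff_of_isMono hS).1
    (h1 : par (a ≫ 𝟙 A) (b ≫ g) _ = par (𝟙 A) (𝟙 A) (id_mem A))
  -- Here `z` is the pullback projection `a`, so `z.inv ≫ b` lifts `f` through `t`; it is the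
  -- candidate inverse of `g`.
  have hzb : z.inv ≫ b ≫ t = f := by
    rw [← H.w, z.inv_comp_eq]
    simpa using (congrArg (· ≫ f) h5).symm
  have hzg : (z.inv ≫ b) ≫ g = 𝟙 A := by
    rw [Category.assoc, z.inv_comp_eq]; exact h6.symm
  have hgz : g ≫ z.inv ≫ b = 𝟙 E := by
    rw [← cancel_mono t, Category.assoc, Category.assoc, hzb, hgf, Category.id_comp]
  have : IsIso (z.inv ≫ b) := ⟨g, hzg, hgz⟩
  rw [← hzb, ← Category.assoc]
  exact S.comp_mem (S.iso_mem _ inferInstance) ht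

lemma mem_of_reIso_eta (hS : S.IsMono) {A B : C} {f : A ⟶ B}
    (hf : reIso (Par S) ((etaFunctor S).map f)) : S.W f :=
  let ⟨_, h1, h2⟩ := hf
  mem_of_par_inverse hS (h1.trans ((etaFunctor S).map f).property) h2

/-- The inverse of `etaFunctor S` when it is fully faithful. -/
noncomputable def etaInverse (S : StableClass C) [(etaFunctor S).Full] [(etaFunctor S).Faithful] :
    Total (Par S) ⥤ C where
  obj A := A.obj.obj
  map {A B} φ := (etaFunctor S).preimage (X := A.obj.obj) (Y := B.obj.obj) φ
  map_id _ := (etaFunctor S).map_injective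
    (((etaFunctor S).map_preimage _).trans ((etaFunctor S).map_id _).symm)
  map_comp φ ψ := (etaFunctor S).map_injective <|
    ((etaFunctor S).map_preimage _).trans <|
      (congrArg₂ (· ≫ ·) ((etaFunctor S).map_preimage φ)
        ((etaFunctor S).map_preimage ψ)).symm.trans ((etaFunctor S).map_comp _ _).symm

section

variable [(etaFunctor S).Full] [(etaFunctor S).Faithful]

lemma etaFunctor_map_etaInverse {A B : Total (Par S)} (φ : A ⟶ B) :
    (etaFunctor S).map ((etaInverse S).map φ) = φ :=
  (etaFunctor S).map_preimage (X := A.obj.obj) (Y := B.obj.obj) φ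

variable (S) in
lemma etaFunctor_comp_etaInverse : etaFunctor S ⋙ etaInverse S = 𝟭 C := by
  refine CategoryTheory.Functor.ext (fun _ => rfl) fun A B f => ?_
  exact ((etaFunctor S).map_injective (etaFunctor_map_etaInverse _)).trans
    ((Category.id_comp _).trans (Category.comp_id _)).symm

variable (S) in
lemma etaInverse_comp_etaFunctor : etaInverse S ⋙ etaFunctor S = 𝟭 (Total (Par S)) := by
  refine CategoryTheory.Functor.ext (fun _ => rfl) fun A B φ => ?_
  exact (etaFunctor_map_etaInverse φ).trans
    ((Category.id_comp _).trans (Category.comp_id _)).symm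

end

/-- If `etaFunctor S` is faithful, then the members of `S` are monomorphisms, because their images
are. -/
lemma isMono_of_etaFunctor_faithful (h : (etaFunctor S).Faithful) : S.IsMono := by
  intro A B s hs
  have := reIsoClass_isMono (X := Par S) _ (reIso_eta hs)
  exact (etaFunctor S).mono_of_mono_map this

end EtaInverse

/-! ### The inverse of the unit as a 1-cell -/

section EtaInverseStable

variable {C : Type u} [Category.{max u w} C] {S : StableClass C}

/-- The unit reflects membership in `S` for monic `S`, and, being fully faithful, it reflects
pullback squares. -/
lemma etaInverse_isStable (hS : S.IsMono) [(etaFunctor S).Full] [(etaFunctor S).Faithful] :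
    IsStableFunctor.{max u w, u} (reIsoClass (Par S)) S (etaInverse S) where
  map_mem {A B s} hs := mem_of_reIso_eta hS (by
    rw [etaFunctor_map_etaInverse]; exact hs)
  map_isPullback {P A E B s' f' f s} hs H := by
    refine IsPullback.of_map (etaFunctor S) ?_ ?_
    · rw [← Functor.map_comp, H.w, Functor.map_comp]
    · rw [etaFunctor_map_etaInverse, etaFunctor_map_etaInverse, etaFunctor_map_etaInverse,
        etaFunctor_map_etaInverse]
      exact H

lemma exists_inverse_etaFunctor (hS : S.IsMono) :
    ∃ G : Total (Par S) ⥤ C, IsStableFunctor.{max u w, u} (reIsoClass (Par S)) S G ∧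
      etaFunctor S ⋙ G = 𝟭 C ∧ G ⋙ etaFunctor S = 𝟭 (Total (Par S)) := by
  have := etaFunctor_full hS
  have := etaFunctor_faithful hS
  exact ⟨etaInverse S, etaInverse_isStable.{w} hS, etaFunctor_comp_etaInverse S,
    etaInverse_comp_etaFunctor S⟩

end EtaInverseStable

/-! ### Full faithfulness of the counit -/

section EpsFunctor

variable {X : Type u} [Category.{v} X] [SplitRestrictionCategory X]

lemma epsFunctor_map_par {A B D : Total X} (s : D ⟶ A) (f : D ⟶ B) (hs : reIso X s) :
    (epsFunctor X).map (par (S := reIsoClass X) s f hs) = reInv s hs ≫ f.hom := rfl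

lemma epsFunctor_map_total {A B : Total X} (f : A ⟶ B) :
    (epsFunctor X).map (par (S := reIsoClass X) (𝟙 A) f (id_mem A)) = f.hom :=
  (congrArg (· ≫ f.hom) (reInv_eq (reIso_of_isIso (𝟙 A))
    (isRestrictedInverse_of_iso (Iso.refl A)))).trans (Category.id_comp _)

lemma rest_epsFunctor_map_par {A B D : Total X} (s : D ⟶ A) (f : D ⟶ B) (hs : reIso X s) :
    rest ((epsFunctor X).map (par (S := reIsoClass X) s f hs)) = reInv s hs ≫ s.hom :=
  (rest_comp_total _ _ f.property).trans (reInv_spec hs).2.symm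

lemma hom_comp_reInv {A D : Total X} {s : D ⟶ A} (hs : reIso X s) :
    s.hom ≫ reInv s hs = 𝟙 D.obj :=
  (reInv_spec hs).1.trans s.property

/-- Equal images have equal restrictions, so the left legs `s` and `t` split one idempotent.
Splittings are unique up to isomorphism, and the comparison `s ≫ t⁻` is an isomorphism of spans. -/
instance epsFunctor_faithful : (epsFunctor X).Faithful where
  map_injective {A B} φ ψ h := by
    induction φ using par_ind with
    | _ D s f hs =>
    induction ψ using par_ind with
    | _ E t g ht =>
      -- The right legs are total, so restricting both images leaves only the idempotents of the
      -- left legs.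
      have hr : reInv s hs ≫ s.hom = reInv t ht ≫ t.hom :=
         (rest_epsFunctor_map_par s f hs).symm.trans
          ((congrArg rest h).trans (rest_epsFunctor_map_par t g ht))
      have h' : reInv s hs ≫ f.hom = reInv t ht ≫ g.hom := h
      have h1 : (s.hom ≫ reInv t ht) ≫ t.hom ≫ reInv s hs = 𝟙 D.obj := by
        rw [Category.assoc, ← Category.assoc (reInv t ht), ← hr, Category.assoc, hom_comp_reInv hs]
        exact (congrArg _ (Category.comp_id _)).trans (hom_comp_reInv hs)
      have h2 : (t.hom ≫ reInv s hs) ≫ s.hom ≫ reInv t ht = 𝟙 E.obj := by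
        rw [Category.assoc, ← Category.assoc (reInv s hs), hr, Category.assoc, hom_comp_reInv ht]
        exact (congrArg _ (Category.comp_id _)).trans (hom_comp_reInv ht)
      have h3 : rest (s.hom ≫ reInv t ht) = 𝟙 D.obj :=
        rest_left _ _ ((congrArg rest h1).trans (rest_eq_id_of_mono _))
      have h4 : rest (t.hom ≫ reInv s hs) = 𝟙 E.obj :=
        rest_left _ _ ((congrArg rest h2).trans (rest_eq_id_of_mono _))
      let e : D ≅ E := ⟨⟨_, h3⟩, ⟨_, h4⟩, WideSubcategory.hom_ext _ h1,
        WideSubcategory.hom_ext _ h2⟩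
      refine par_eq_of_star e.hom (@star_of_isIso _ _ _ _ _ e.hom e.isIso_hom) (WideSubcategory.hom_ext _ ?_)
        (WideSubcategory.hom_ext _ ?_)
      · show (s.hom ≫ reInv t ht) ≫ t.hom = s.hom
        rw [Category.assoc, ← hr, ← Category.assoc, hom_comp_reInv hs]
        exact Category.id_comp _
      · show (s.hom ≫ reInv t ht) ≫ g.hom = f.hom
        rw [Category.assoc, ← h', ← Category.assoc, hom_comp_reInv hs]
        exact Category.id_comp _

/-- If `rest f` splits as `r ≫ m`, then `m` is the domain inclusion of `f` with restricted inverse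
`r`, and the span of `m` and `m ≫ f` maps to `rest f ≫ f = f`. -/
instance epsFunctor_full : (epsFunctor X).Full where
  map_surjective {A B} f := by
    obtain ⟨P, r, m, h1, h2⟩ := split (rest f)
      (by simpa [rest_eq_id_of_mono] using rest_rest f (𝟙 _))
    have hm : rest m = 𝟙 P := rest_left m r (by rw [h2]; exact rest_eq_id_of_mono _)
    have hmf : rest (m ≫ f) = 𝟙 P := by
      have hme : m ≫ rest f = m := by rw [← h1, ← Category.assoc, h2, Category.id_comp]
      rw [← rest_comp_rest, hme, hm]
    have hr : r ≫ m = rest r := by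
      rw [← rest_comp_total r m hm, h1]
      simpa [rest_eq_id_of_mono] using (rest_rest f (𝟙 _)).symm
    let s : (⟨P⟩ : Total X) ⟶ A.obj := ⟨m, hm⟩
    let g : (⟨P⟩ : Total X) ⟶ B.obj := ⟨m ≫ f, hmf⟩
    have hs : IsRestrictedInverse s.hom r := ⟨h2.trans hm.symm, hr⟩
    refine ⟨par (S := reIsoClass X) s g ⟨r, hs⟩,
      (congrArg (· ≫ g.hom) (reInv_eq ⟨r, hs⟩ hs)).trans ?_⟩
    show r ≫ m ≫ f = f
    rw [← Category.assoc, h1, rest_comp]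

lemma epsFunctor_map_preimage {A B : X} (f : A ⟶ B) :
    (epsFunctor X).map ((epsFunctor X).preimage (X := (⟨⟨A⟩⟩ : Par (reIsoClass X)))
      (Y := (⟨⟨B⟩⟩ : Par (reIsoClass X))) f) = f :=
  (epsFunctor X).map_preimage _

variable (X) in
/-- The inverse of `epsFunctor X`. -/
noncomputable def epsInverse : X ⥤ Par (reIsoClass X) where
  obj A := ⟨⟨A⟩⟩
  map {A B} f := (epsFunctor X).preimage (X := (⟨⟨A⟩⟩ : Par (reIsoClass X)))
    (Y := (⟨⟨B⟩⟩ : Par (reIsoClass X))) f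
  map_id A := (epsFunctor X).map_injective
    ((epsFunctor_map_preimage (𝟙 A)).trans
      ((epsFunctor X).map_id (⟨⟨A⟩⟩ : Par (reIsoClass X))).symm)
  map_comp f g := (epsFunctor X).map_injective <|
    ((epsFunctor X).map_preimage _).trans <|
      (congrArg₂ (· ≫ ·) (epsFunctor_map_preimage f)
        (epsFunctor_map_preimage g)).symm.trans ((epsFunctor X).map_comp _ _).symm

lemma epsFunctor_map_epsInverse {A B : X} (f : A ⟶ B) :
    (epsFunctor X).map ((epsInverse X).map f) = f :=
  epsFunctor_map_preimage f

variable (X) in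
lemma epsFunctor_comp_epsInverse : epsFunctor X ⋙ epsInverse X = 𝟭 (Par (reIsoClass X)) := by
  refine CategoryTheory.Functor.ext (fun _ => rfl) fun A B φ => ?_
  exact ((epsFunctor X).map_injective (epsFunctor_map_epsInverse _)).trans
    ((Category.id_comp _).trans (Category.comp_id _)).symm

variable (X) in
lemma epsInverse_comp_epsFunctor : epsInverse X ⋙ epsFunctor X = 𝟭 X := by
  refine CategoryTheory.Functor.ext (fun _ => rfl) fun A B f => ?_
  exact (epsFunctor_map_epsInverse f).trans
    ((Category.id_comp _).trans (Category.comp_id _)).symm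

end EpsFunctor

/-! ### The counit and its inverse as 1-cells -/

section EpsRestriction

variable {X : Type u} [Category.{max u w} X] [SplitRestrictionCategory X]

variable (X) in
lemma epsFunctor_isRestriction : IsRestrictionFunctor.{max u w, u} (epsFunctor X) := by
  intro A B φ
  induction φ using par_ind with
  | _ D s f hs => exact (rest_epsFunctor_map_par s f hs).symm

variable (X) in
lemma epsInverse_isRestriction : IsRestrictionFunctor.{max u w, u} (epsInverse X) := by
  intro A B f
  -- The inverse inherits preservation of restrictions because the counit is faithful and preserves
  -- them.
  refine (epsFunctor X).map_injective ((epsFunctor_map_epsInverse _).trans ?_)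
  exact (congrArg rest (epsFunctor_map_epsInverse f)).symm.trans
    (epsFunctor_isRestriction.{w} X _).symm

end EpsRestriction

/-! ### Transport of 2-cells, and invertible 1-cells -/

/-- 2-cells correspond along equalities of 1-cells when their components do. -/
lemma TwoCat.comp_eqToHom_eq {O : Type u'} {D : TwoCatData.{v, u} O} {X Y : TwoCat D}
    {F G F' G' : X ⟶ Y} (h : F = F') (h' : G = G') (α : F ⟶ G) (β : F' ⟶ G')
    (e : ∀ x, α.nat.app x ≍ β.nat.app x) : α ≫ eqToHom h' = eqToHom h ≫ β := by
  subst h h'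
  simpa using ext₂ fun x => eq_of_heq (e x)

lemma TwoCat.isIsomorphism_of_functor {O : Type u'} {D : TwoCatData.{v, u} O} {X Y : TwoCat D}
    {F : X ⟶ Y} {G : D.cat Y.obj ⥤ D.cat X.obj} (hG : D.P₁ Y.obj X.obj G)
    (h₁ : F.functor ⋙ G = 𝟭 _) (h₂ : G ⋙ F.functor = 𝟭 _) : IsIsomorphism F :=
  ⟨⟨G, hG⟩, TwoCat.hom_ext h₁, TwoCat.hom_ext h₂⟩

lemma TwoCat.faithful_of_isIsomorphism {O : Type u'} {D : TwoCatData.{v, u} O} {X Y : TwoCat D}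
    {F : X ⟶ Y} (hF : IsIsomorphism F) : F.functor.Faithful := by
  obtain ⟨G, hG, -⟩ := hF
  have h : F.functor ⋙ G.functor = 𝟭 _ := congrArg Hom₁.functor hG
  have : (F.functor ⋙ G.functor).Faithful := h ▸ inferInstance
  exact Functor.Faithful.of_comp F.functor G.functor

/-! ### Naturality and triangle identities on underlying functors -/

section Naturality

variable {C D : Type u} [Category.{max u w} C] [Category.{max u w} D] {S : StableClass C}
  {T : StableClass D}

lemma etaFunctor_naturality {F : C ⥤ D} (hF : IsConsistentFunctor.{max u w, u} S T F) :
    F ⋙ etaFunctor T = etaFunctor S ⋙ totalFunctor (parFunctor_isRestriction hF) := by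
  refine CategoryTheory.Functor.ext (fun _ => rfl) fun A B f => ?_
  refine Eq.trans ?_ ((Category.id_comp _).trans (Category.comp_id _)).symm
  exact WideSubcategory.hom_ext _ (par_congr (F.map_id A).symm rfl)

variable (S) in
lemma par_eta_comp_eps :
    parFunctor (etaFunctor_isConsistent.{w} S) ⋙ epsFunctor (Par S) = 𝟭 (Par S) := by
  refine CategoryTheory.Functor.ext (fun _ => rfl) fun X Y φ => ?_
  refine Eq.trans ?_ ((Category.id_comp _).trans (Category.comp_id _)).symm
  induction φ using par_ind with
  | _ E s f hs =>
    -- By uniqueness, the chosen restricted inverse of `[1, s]` is `[s, 1]`, and `[s, 1] ≫ [1, f] =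
    -- [s, f]`.
    refine (congrArg (· ≫ par (𝟙 E) f (id_mem E))
      (reInv_eq (reIso_eta hs) (isRestrictedInverse_eta s hs))).trans ?_
    exact par_fac s f hs

end Naturality

section Naturality

variable {X Y : Type u} [Category.{max u w} X] [Category.{max u w} Y]
  [SplitRestrictionCategory X] [SplitRestrictionCategory Y]

lemma epsFunctor_naturality {F : X ⥤ Y} (hF : IsRestrictionFunctor.{max u w, u} F) :
    parFunctor ((totalFunctor_isStable hF).isConsistent reIsoClass_isMono) ⋙ epsFunctor Y =
      epsFunctor X ⋙ F := by
  refine CategoryTheory.Functor.ext (fun _ => rfl) fun A B φ => ?_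
  refine Eq.trans ?_ ((Category.id_comp _).trans (Category.comp_id _)).symm
  induction φ using par_ind with
  | _ E s f hs =>
    -- `F` carries the restricted inverse of `s` to one of `F s`, and there is only one.
    refine (congrArg (· ≫ F.map f.hom)
      (reInv_eq ((totalFunctor_isStable hF).map_mem hs) ((reInv_spec hs).map hF))).trans ?_
    exact (F.map_comp _ _).symm

variable (X) in
lemma eta_comp_total_eps :
    etaFunctor (reIsoClass X) ⋙ totalFunctor (epsFunctor_isRestriction.{w} X) =
      𝟭 (Total X) := by
  refine CategoryTheory.Functor.ext (fun _ => rfl) fun A B f => ?_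
  refine Eq.trans ?_ ((Category.id_comp _).trans (Category.comp_id _)).symm
  exact WideSubcategory.hom_ext _ (epsFunctor_map_total f)

end Naturality

/-! ### The 2-adjunction and its restriction to monic classes -/

/-- The unit `f ↦ [1, f]` of the adjunction between `Par` and `Total`. -/
noncomputable def parTotalUnit :
    TwoNatTrans (StrictPseudofunctor.id ConsistentStableCat.{w, u}) (parTwo.comp total) where
  app X := Hom₁.mk (etaFunctor X.obj.S) (etaFunctor_isConsistent.{w} X.obj.S)
  naturality F := TwoCat.hom_ext (etaFunctor_naturality F.prop)
  naturality₂ _ := TwoCat.comp_eqToHom_eq _ _ _ _ fun _ => HEq.rfl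

/-- The counit `[s, f] ↦ f · s⁻` of the adjunction between `Par` and `Total`. -/
noncomputable def parTotalCounit :
    TwoNatTrans (total.comp parTwo) (StrictPseudofunctor.id SplitRestCat.{w, u}) where
  app Y := Hom₁.mk (epsFunctor Y.obj.carrier) (epsFunctor_isRestriction.{w} Y.obj.carrier)
  naturality F := TwoCat.hom_ext (epsFunctor_naturality F.prop)
  naturality₂ _ := TwoCat.comp_eqToHom_eq _ _ _ _ fun _ => heq_of_eq (epsFunctor_map_total _)

/-- The 2-adjunction between `Par` and `Total`. -/
noncomputable def parTotalAdj : TwoAdjunction parTwo.{w, u} total.{w, u} where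
  unit := parTotalUnit
  counit := parTotalCounit
  left_triangle X := TwoCat.hom_ext (par_eta_comp_eps.{w} X.obj.S)
  right_triangle Y := TwoCat.hom_ext (eta_comp_total_eps.{w} Y.obj.carrier)

/-- The unit `f ↦ [1, f]` on classes of monomorphisms. -/
noncomputable def parTotalMonoUnit :
    TwoNatTrans (StrictPseudofunctor.id StableCatMono.{w, u}) (parMono.comp totalMono) where
  app X := Hom₁.mk (etaFunctor X.obj.1.S) (etaFunctor_isStable.{w} X.obj.1.S)
  naturality {X _} F := TwoCat.hom_ext (etaFunctor_naturality (F.prop.isConsistent X.obj.2))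
  naturality₂ _ := TwoCat.comp_eqToHom_eq _ _ _ _ fun _ => HEq.rfl

/-- The counit `[s, f] ↦ f · s⁻`, for the corestriction of `Total` to classes of monomorphisms. -/
noncomputable def parTotalMonoCounit :
    TwoNatTrans (totalMono.comp parMono) (StrictPseudofunctor.id SplitRestCat.{w, u}) where
  app Y := Hom₁.mk (epsFunctor Y.obj.carrier) (epsFunctor_isRestriction.{w} Y.obj.carrier)
  naturality F := TwoCat.hom_ext (epsFunctor_naturality F.prop)
  naturality₂ _ := TwoCat.comp_eqToHom_eq _ _ _ _ fun _ => heq_of_eq (epsFunctor_map_total _)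

/-- The restriction of the 2-adjunction between `Par` and `Total` to classes of monomorphisms. -/
noncomputable def parTotalMonoAdj : TwoAdjunction parMono.{w, u} totalMono.{w, u} where
  unit := parTotalMonoUnit
  counit := parTotalMonoCounit
  left_triangle X := TwoCat.hom_ext (par_eta_comp_eps.{w} X.obj.1.S)
  right_triangle Y := TwoCat.hom_ext (eta_comp_total_eps.{w} Y.obj.carrier)

/-! ### Invertibility of unit and counit -/

lemma isIsomorphism_unit_iff (X : ConsistentStableCat.{w, u}) :
    IsIsomorphism (parTotalAdj.{w, u}.unit.app X) ↔ X.obj.S.IsMono := by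
  refine ⟨fun h => isMono_of_etaFunctor_faithful (TwoCat.faithful_of_isIsomorphism h),
    fun hS => ?_⟩
  obtain ⟨G, hG, h₁, h₂⟩ := exists_inverse_etaFunctor.{w} hS
  -- The inverse is consistent for free, since its source carries a class of monomorphisms.
  exact TwoCat.isIsomorphism_of_functor (hG.isConsistent reIsoClass_isMono) h₁ h₂

/-- An inverse among the more general stable functors gives nothing new: necessity uses only
faithfulness of the underlying functor. -/
lemma isIsomorphism_incl_unit_iff (X : ConsistentStableCat.{w, u}) :
    IsIsomorphism (consistentIncl.map (parTotalAdj.{w, u}.unit.app X)) ↔ X.obj.S.IsMono := by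
  refine ⟨fun h => isMono_of_etaFunctor_faithful (TwoCat.faithful_of_isIsomorphism h),
    fun hS => ?_⟩
  obtain ⟨G, hG, h₁, h₂⟩ := exists_inverse_etaFunctor.{w} hS
  exact TwoCat.isIsomorphism_of_functor hG h₁ h₂

lemma isIsomorphism_mono_unit (X : StableCatMono.{w, u}) :
    IsIsomorphism (parTotalMonoAdj.{w, u}.unit.app X) := by
  obtain ⟨G, hG, h₁, h₂⟩ := exists_inverse_etaFunctor.{w} X.obj.2
  exact TwoCat.isIsomorphism_of_functor hG h₁ h₂

lemma isIsomorphism_counit (Y : SplitRestCat.{w, u}) :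
    IsIsomorphism (parTotalAdj.{w, u}.counit.app Y) :=
  TwoCat.isIsomorphism_of_functor (G := epsInverse Y.obj.carrier)
    (epsInverse_isRestriction.{w} Y.obj.carrier) (epsFunctor_comp_epsInverse _)
    (epsInverse_comp_epsFunctor _)

/-- Composing a cospan with a monomorphism does not change its pullback, so conjugates and their
pullbacks are invertible; conversely every isomorphism lies in `S⋆`. -/
lemma SSpan.rel_iff_isIsomorphic {C : Type u} [Category.{v} C] {S : StableClass C}
    (hS : S.IsMono) {A B : C} (p q : SSpan S A B) : p.Rel q ↔ p.IsIsomorphic q :=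
  ⟨fun h => h.isIsomorphic hS, fun ⟨x, h1, h2⟩ =>
    .rel _ _ ⟨x.hom, star_of_isIso _, h1, h2⟩⟩

end PartialMaps

theorem mainTheorem6 :
    -- `Par ⊣ Total`, with unit `f ↦ [1, f]` and counit `[s, f] ↦ f · s⁻`
    ∃ adj : PartialMaps.TwoAdjunction PartialMaps.parTwo.{w, u} PartialMaps.total.{w, u},
      (∀ X : PartialMaps.ConsistentStableCat.{w, u},
        (adj.unit.app X).functor = PartialMaps.etaFunctor X.obj.S) ∧
      (∀ Y : PartialMaps.SplitRestCat.{w, u},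
        (adj.counit.app Y).functor = PartialMaps.epsFunctor Y.obj.carrier) ∧
      -- the fixed objects: the unit is invertible exactly at classes of monomorphisms
      (∀ X : PartialMaps.ConsistentStableCat.{w, u},
        PartialMaps.IsIsomorphism (adj.unit.app X) ↔ X.obj.S.IsMono) ∧
      (∀ X : PartialMaps.ConsistentStableCat.{w, u},
        PartialMaps.IsIsomorphism (PartialMaps.consistentIncl.map (adj.unit.app X)) ↔
          X.obj.S.IsMono) ∧
      (∀ Y : PartialMaps.SplitRestCat.{w, u}, PartialMaps.IsIsomorphism (adj.counit.app Y)) ∧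
      -- the restriction to the fixed objects is a 2-equivalence
      (∃ adjMono : PartialMaps.TwoAdjunction PartialMaps.parMono.{w, u}
          PartialMaps.totalMono.{w, u},
        (∀ X : PartialMaps.StableCatMono.{w, u}, (adjMono.unit.app X).functor =
          (adj.unit.app (PartialMaps.monoIncl.obj X)).functor) ∧
        (∀ Y : PartialMaps.SplitRestCat.{w, u}, adjMono.counit.app Y = adj.counit.app Y) ∧
        adjMono.IsTwoEquivalence) ∧
      -- on these objects `Par` is the ordinary category of isomorphism classes of spans
      (∀ (X : PartialMaps.StableCatMono.{w, u}) (A B : X.obj.1.carrier)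
        (p q : PartialMaps.SSpan X.obj.1.S A B), p.Rel q ↔ p.IsIsomorphic q) := by
  exact ⟨PartialMaps.parTotalAdj, fun _ => rfl, fun _ => rfl,
    PartialMaps.isIsomorphism_unit_iff, PartialMaps.isIsomorphism_incl_unit_iff,
    PartialMaps.isIsomorphism_counit,
    ⟨PartialMaps.parTotalMonoAdj, fun _ => rfl, fun _ => rfl,
      PartialMaps.isIsomorphism_mono_unit, PartialMaps.isIsomorphism_counit⟩,
    fun X _ _ p q => PartialMaps.SSpan.rel_iff_isIsomorphic X.obj.2 p q⟩
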